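/- Let $K$ be an infinite field of characteristic different from $2$ and $3$. Algebras over $K$ are $K$-vector spaces with a $K$-bilinear product, not necessarily associative, unital or finite-dimensional. A Bernstein algebra over $K$ is a commutative $K$-algebra $A$ together with a nonzero algebra homomorphism $\omega : A \to K$ such that $(x^2)^2 = \omega(x)^2 x^2$ for all $x \in A$; its barideal is $N = \ker \omega$. An algebra is Noetherian (Artinian) if every ascending (descending) sequence of its two-sided ideals is stationary, and locally nilpotent if each of its finitely generated subalgebras $S$ is nilpotent, i.e. satisfies $S^n = 0$ for some $n \ge 1$, where $S^1 = S$ and $S^n = \sum_{r+s=n,\ r,s\ge 1} S^r S^s$. (1) Let $A$ be a Bernstein algebra over $K$ whose barideal $N$ is locally nilpotent. If $A$ is Noetherian, then $A$ is finite-dimensional over $K$. (2) The Artinian analogue fails: over every such field $K$ there is an Artinian Bernstein algebra whose barideal is locally nilpotent and which is infinite-dimensional over $K$. -/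

import Mathlib

universe u v

/- Throughout, an algebra over a field `K` is a `K`-module with a `K`-bilinear product; neither
associativity nor a unit is required. In Mathlib this is expressed by the type classes
`NonUnitalNonAssocRing`, `Module K`, `IsScalarTower K A A` and `SMulCommClass K A A`. -/

namespace BernsteinAlg

section General

variable (K : Type u) [Field K] (A : Type v) [NonUnitalNonAssocRing A] [Module K A]

variable {K A} in
/-- A subspace of an algebra is a two-sided ideal if it absorbs products on both sides. -/
def IsIdeal (I : Submodule K A) : Prop :=
  ∀ a : A, ∀ x ∈ I, a * x ∈ I ∧ x * a ∈ I

/-- An algebra is Noetherian if every ascending sequence of two-sided ideals is stationary. -/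
def IsNoetherianAlgebra : Prop :=
  ∀ I : ℕ → Submodule K A, (∀ n, IsIdeal (I n)) → Monotone I →
    ∃ n, ∀ m, n ≤ m → I m = I n

/-- An algebra is Artinian if every descending sequence of two-sided ideals is stationary. -/
def IsArtinianAlgebra : Prop :=
  ∀ I : ℕ → Submodule K A, (∀ n, IsIdeal (I n)) → Antitone I →
    ∃ n, ∀ m, n ≤ m → I m = I n

variable [IsScalarTower K A A] [SMulCommClass K A A]

/-- The powers of an algebra: `A ^ 1 = A`, and `A ^ n` is the sum of the subspaces
`A ^ r * A ^ s` (spanned by products) over `r + s = n` with `r, s ≥ 1`.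
The index `0` is not meaningful; it is given the value `A`. -/
def power : ℕ → Submodule K A
  | 0 => ⊤
  | 1 => ⊤
  | n + 2 => ⨆ i : Fin (n + 1),
      Submodule.map₂ (LinearMap.mul K A) (power (i.1 + 1)) (power (n + 1 - i.1))
  termination_by n => n
  decreasing_by all_goals omega

/-- An algebra is nilpotent if one of its powers vanishes. -/
def IsNilpotentAlgebra : Prop :=
  ∃ n : ℕ, 1 ≤ n ∧ power K A n = ⊥

/-- An algebra is locally nilpotent if each of its finitely generated subalgebras is nilpotent. -/
def IsLocallyNilpotent : Prop :=
  ∀ s : Finset A, IsNilpotentAlgebra K (NonUnitalAlgebra.adjoin K (s : Set A))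

end General

section Bernstein

variable {K : Type u} [Field K] {A : Type v} [NonUnitalNonAssocCommRing A] [Module K A]

/-- A commutative algebra `A` with a homomorphism `ω : A → K` is a Bernstein algebra with weight
function `ω` if `ω ≠ 0` and `(x²)² = ω(x)² x²` for all `x`. -/
structure IsBernstein (ω : A →ₙₐ[K] K) : Prop where
  weight_ne_zero : ω ≠ 0
  sq_sq : ∀ x : A, (x * x) * (x * x) = (ω x) ^ 2 • (x * x)

/-- The barideal `N = ker ω`, as a subalgebra of `A`, and so as an algebra in its own right. -/
def barideal (ω : A →ₙₐ[K] K) : NonUnitalSubalgebra K A where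
  carrier := {x | ω x = 0}
  add_mem' := by
    intro a b ha hb
    simp_all
  zero_mem' := by simp
  mul_mem' := by
    intro a b ha hb
    simp_all
  smul_mem' := by
    intro c x hx
    simp_all

end Bernstein

end BernsteinAlg

/-! Finiteness for Noetherian algebras comes from solvability of the barideal through ideals of `A`.
An idempotent `e` of weight 1 splits `A = Ke + U + V`, where `N = U + V`, `U` and `V` being the
eigenspaces of `e` on `N` for 1/2 and 0 (`IsBernstein.peirceRules`). The operators on `U` given by
multiplication with elements of `V` are skew for the product `U × U → V` and anticommute modulo the
annihilator of `U`. Combined with the cyclic identity, this makes three successive operators from `U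
* U` send `U` into that annihilator (`IsPeircePair.mul_mul_mul`). The iterated annihilators
therefore exhaust `U` after three steps, and they give ideals `N ⊇ chain 3 ⊇ chain 2 ⊇ chain 1 ⊇
chain 0 ⊇ annih 0 ⊇ 0`, each containing the products of elements of its predecessor.

Codimension stays finite along this chain (`IsNoetherianAlgebra.fg_sup_eq_top`). If `A / I` is
finite-dimensional and `I * I ⊆ J`, then only finitely many directions of `A` act on `I / J`.
Finitely generated subalgebras of `N` are finite-dimensional by local nilpotency. Suitable ones, cut
with `I` and enlarged by `J`, are ideals, and a maximal such ideal is `I` itself.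

For the Artinian counterexample, a single element of `V` acts on an infinite-dimensional `U` as the
left shift of finitely supported sequences. The shift is locally nilpotent, and its proper stable
subspaces are finite-dimensional, so descending chains stop. -/

set_option linter.unusedSectionVars false

namespace BernsteinAlg

/-! ### Products between Peirce components and iterated annihilators -/

/-- The products `B : U × U → V` and `R : U × V → U` between the Peirce components of the
barideal of a Bernstein algebra, with the identities that they satisfy. -/
structure IsPeircePair {K : Type u} [Field K] {U V : Type v} [AddCommGroup U] [Module K U]
    [AddCommGroup V] [Module K V] (B : U →ₗ[K] U →ₗ[K] V) (R : U →ₗ[K] V →ₗ[K] U) : Prop where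
  comm : ∀ a b, B a b = B b a
  cyclic : ∀ a b c, R a (B b c) + R b (B c a) + R c (B a b) = 0
  skew : ∀ a b v, B a (R b v) = -B b (R a v)
  mul_self : ∀ a v, B (R a v) (R a v) = 0

namespace IsPeircePair

variable {K : Type u} [Field K] {U V : Type v} [AddCommGroup U] [Module K U]
    [AddCommGroup V] [Module K V] {B : U →ₗ[K] U →ₗ[K] V} {R : U →ₗ[K] V →ₗ[K] U}

theorem eq_zero_of_add_self {M : Type*} [AddCommGroup M] [Module K M] (h2 : (2 : K) ≠ 0) {x : M}
    (h : x + x = 0) : x = 0 := by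
  rw [← two_smul K] at h
  exact (smul_eq_zero.mp h).resolve_left h2

/-- Polarizing `mul_self` in `v` and then in `a` gives a relation between `B (R a v) (R b w)` and `B
(R b v) (R a w)`; skewness moves the operators onto one side. -/
theorem anti (H : IsPeircePair B R) (h2 : (2 : K) ≠ 0) (a b : U) (v w : V) :
    B a (R (R b v) w) = -B a (R (R b w) v) := by
  have h1 : ∀ (a : U) (v w : V), B (R a v) (R a w) = 0 := by
    intro a v w
    have h := H.mul_self a (v + w)
    simp only [map_add, LinearMap.add_apply, H.mul_self, H.comm (R a w) (R a v), zero_add,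
      add_zero] at h
    exact eq_zero_of_add_self h2 h
  have h := h1 (a + b) v w
  simp only [map_add, LinearMap.add_apply, h1, zero_add, add_zero] at h
  rw [H.skew a, H.skew a (R b w), H.comm (R b w) (R a v), neg_neg, eq_comm, ← sub_eq_zero,
    sub_neg_eq_add]
  rwa [add_comm] at h

theorem anti_fst (H : IsPeircePair B R) (h2 : (2 : K) ≠ 0) (a b : U) (v w : V) :
    B (R (R b v) w) a = -B (R (R b w) v) a := by
  rw [H.comm, H.anti h2, H.comm a]

theorem skew_fst (H : IsPeircePair B R) (a b : U) (v : V) : B (R a v) b = -B a (R b v) := by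
  rw [H.comm, H.skew]

theorem swap_left (H : IsPeircePair B R) (h2 : (2 : K) ≠ 0) (a h : U) (v w x : V) :
    B (R (R (R a v) w) x) h = -B (R (R (R a w) v) x) h := by
  rw [H.skew_fst, H.anti_fst h2, H.skew_fst (R (R a w) v)]

theorem swap_right (H : IsPeircePair B R) (h2 : (2 : K) ≠ 0) (a h : U) (v w x : V) :
    B (R (R (R a v) w) x) h = -B (R (R (R a v) x) w) h :=
  H.anti_fst h2 _ _ _ _

/-- The cyclic identity rewrites the action of a square, and both sides become `2 • B (R b w) (R a
(B a (R b x)))`. The effect is to trade the outer vector for the one whose square acts in the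
middle. -/
theorem exchange (H : IsPeircePair B R) (h2 : (2 : K) ≠ 0) (a b : U) (x w : V) :
    B (R (R (R a x) (B b b)) w) a = B (R (R (R b x) (B a a)) w) b := by
  have e1 : R (R a x) (B b b) = -(R b (B (R a x) b) + R b (B (R a x) b)) := by
    have h := H.cyclic (R a x) b b
    rw [H.comm b (R a x), add_assoc] at h
    exact eq_neg_of_add_eq_zero_left h
  have e2 : B (R (R b (B (R a x) b)) w) a = -B (R b w) (R a (B a (R b x))) := by
    rw [H.anti_fst h2, H.skew_fst (R b w), neg_neg, H.skew_fst a, map_neg, map_neg]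
  have e3 : R (R b x) (B a a) = -(R a (B a (R b x)) + R a (B a (R b x))) := by
    have h := H.cyclic (R b x) a a
    rw [H.comm (R b x) a, add_assoc] at h
    exact eq_neg_of_add_eq_zero_left h
  rw [e1]
  simp only [map_neg, map_add, LinearMap.neg_apply, LinearMap.add_apply, e2]
  rw [H.skew_fst (R (R b x) (B a a)), H.comm (R (R b x) (B a a)) (R b w), e3]
  simp only [map_neg, map_add]
  abel

theorem mul_sq_sq_sq (H : IsPeircePair B R) (h2 : (2 : K) ≠ 0) (a b c d : U) :
    B (R (R (R a (B b b)) (B c c)) (B d d)) a = 0 := by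
  have h : B (R (R (R a (B c c)) (B b b)) (B d d)) a
      = -B (R (R (R a (B c c)) (B b b)) (B d d)) a := by
    -- Three exchanges, each followed by a transposition of operators, rotate `a`, `b`, `c` back to
    -- the starting arrangement with sign `(-1)^3`, so the expression equals its own negative.
    conv_lhs => rw [H.exchange h2, H.swap_left h2, H.exchange h2, H.swap_left h2, H.exchange h2,
      H.swap_left h2]
    simp
  rw [H.swap_left h2, neg_eq_zero]
  refine eq_zero_of_add_self h2 ?_
  nth_rewrite 1 [h]
  exact neg_add_cancel _

/-- Squares span all products `B b c` since 2 is invertible, so the vanishing on squares extends to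
arbitrary operators from `U * U`. The resulting bilinear form in `a` and `h` is alternating and also
symmetric, hence zero. -/
theorem mul_mul_mul (H : IsPeircePair B R) (h2 : (2 : K) ≠ 0) (a b b' c c' d d' h : U) :
    B (R (R (R a (B b b')) (B c c')) (B d d')) h = 0 := by
  set S := Submodule.span K (Set.range fun b => B b b) with hS
  have hB : ∀ b c, B b c ∈ S := by
    intro b c
    have hsq : ∀ b, B b b ∈ S := fun b => Submodule.subset_span ⟨b, rfl⟩
    have h1 : B (b + c) (b + c) - B b b - B c c = (2 : K) • B b c := by
      simp only [map_add, LinearMap.add_apply, H.comm c b, two_smul]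
      abel
    have h3 := S.sub_mem (S.sub_mem (hsq (b + c)) (hsq b)) (hsq c)
    rw [h1] at h3
    exact (S.smul_mem_iff h2).mp h3
  have key : ∀ v ∈ S, ∀ w ∈ S, ∀ x ∈ S, ∀ a, B (R (R (R a v) w) x) a = 0 := by
    intro v hv
    induction hv using Submodule.span_induction with
    | zero => simp
    | add y z _ _ hy hz => intro w hw x hx a; simp [hy w hw x hx a, hz w hw x hx a]
    | smul r y _ hy => intro w hw x hx a; simp [hy w hw x hx a]
    | mem v hv =>
      obtain ⟨b, rfl⟩ := hv
      intro w hw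
      induction hw using Submodule.span_induction with
      | zero => simp
      | add y z _ _ hy hz => intro x hx a; simp [hy x hx a, hz x hx a]
      | smul r y _ hy => intro x hx a; simp [hy x hx a]
      | mem w hw =>
        obtain ⟨c, rfl⟩ := hw
        intro x hx
        induction hx using Submodule.span_induction with
        | zero => simp
        | add y z _ _ hy hz => intro a; simp [hy a, hz a]
        | smul r y _ hy => intro a; simp [hy a]
        | mem x hx =>
          obtain ⟨d, rfl⟩ := hx
          exact fun a => H.mul_sq_sq_sq h2 a b c d
  have key' := key _ (hB b b') _ (hB c c') _ (hB d d')
  have hsum := key' (a + h)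
  simp only [map_add, LinearMap.add_apply, key', zero_add, add_zero] at hsum
  -- Moving three skew operators across the form costs `(-1)^3`, and restoring their order is an odd
  -- permutation; the two signs cancel.
  have hsymm : B (R (R (R h (B b b')) (B c c')) (B d d')) a
      = B (R (R (R a (B b b')) (B c c')) (B d d')) h := by
    rw [H.skew_fst, H.skew_fst, H.skew_fst, H.comm, H.swap_left h2, H.swap_right h2,
      H.swap_left h2]
    simp
  rw [hsymm] at hsum
  exact eq_zero_of_add_self h2 hsum

variable (B R) in
/-- The iterated annihilators: `annih 0` is the annihilator of `U` in `U`, and `annih (k + 1)`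
consists of the elements that are multiplied into `annih k` by `U * U`. -/
def annih : ℕ → Submodule K U
  | 0 => LinearMap.ker B
  | k + 1 =>
    { carrier := {l | ∀ b c, R l (B b c) ∈ annih k}
      add_mem' := by
        intro x y hx hy b c
        simpa using (annih k).add_mem (hx b c) (hy b c)
      zero_mem' := by simp
      smul_mem' := by
        intro r x hx b c
        simpa using (annih k).smul_mem r (hx b c) }

theorem mem_annih_zero {l : U} : l ∈ annih B R 0 ↔ ∀ u, B l u = 0 := by
  simp only [annih, LinearMap.mem_ker]
  exact ⟨fun h u => by simp [h], fun h => LinearMap.ext h⟩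

theorem mem_annih_succ {k : ℕ} {l : U} :
    l ∈ annih B R (k + 1) ↔ ∀ b c, R l (B b c) ∈ annih B R k := by
  rw [annih]; rfl

theorem annih_zero_mul (H : IsPeircePair B R) {l : U} (hl : l ∈ annih B R 0) (v : V) :
    R l v ∈ annih B R 0 := by
  rw [mem_annih_zero] at hl ⊢
  intro u
  rw [H.skew_fst, hl, neg_zero]

theorem annih_le_succ (H : IsPeircePair B R) (k : ℕ) : annih B R k ≤ annih B R (k + 1) := by
  induction k with
  | zero => exact fun l hl => mem_annih_succ.mpr fun b c => H.annih_zero_mul hl _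
  | succ k ih =>
    exact fun l hl => mem_annih_succ.mpr fun b c => ih (mem_annih_succ.mp hl b c)

theorem annih_zero_le (H : IsPeircePair B R) (k : ℕ) : annih B R 0 ≤ annih B R k := by
  induction k with
  | zero => exact le_rfl
  | succ k ih => exact ih.trans (H.annih_le_succ k)

theorem anti_mem (H : IsPeircePair B R) (h2 : (2 : K) ≠ 0) (b : U) (v w : V) :
    R (R b v) w + R (R b w) v ∈ annih B R 0 := by
  rw [mem_annih_zero]
  intro u
  rw [map_add, LinearMap.add_apply, H.anti_fst h2, neg_add_cancel]

/-- Two operators may be exchanged when testing for membership in an iterated annihilator. -/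
theorem mem_annih_comm (H : IsPeircePair B R) (h2 : (2 : K) ≠ 0) {k : ℕ} {b : U} {v w : V}
    (h : R (R b v) w ∈ annih B R k) : R (R b w) v ∈ annih B R k :=
  ((annih B R k).add_mem_iff_right h).mp (H.annih_zero_le k (H.anti_mem h2 b v w))

theorem annih_mul (H : IsPeircePair B R) (h2 : (2 : K) ≠ 0) (k : ℕ) :
    ∀ {l : U}, l ∈ annih B R k → ∀ v, R l v ∈ annih B R k := by
  induction k with
  | zero => exact H.annih_zero_mul
  | succ k ih =>
    intro l hl v
    rw [mem_annih_succ] at hl ⊢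
    exact fun b c => H.mem_annih_comm h2 (ih (hl b c) v)

/-- After the two operators are interchanged, the cyclic identity for `R u' (B b c)`, `u`, `l`
leaves one term controlled by the hypothesis on `l` and, by skewness, one controlled by induction.
This is what makes `U * annih k` fit into the ideal `chain k`. -/
theorem mul_mul_annih (H : IsPeircePair B R) (h2 : (2 : K) ≠ 0) (k : ℕ) :
    ∀ {l : U}, l ∈ annih B R k → ∀ u u', R u' (B u l) ∈ annih B R k := by
  induction k with
  | zero =>
    intro l hl u u'
    rw [H.comm, mem_annih_zero.mp hl, map_zero]
    exact Submodule.zero_mem _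
  | succ k ih =>
    intro l hl u u'
    rw [mem_annih_succ] at hl ⊢
    intro b c
    refine H.mem_annih_comm h2 ?_
    have h1 := H.cyclic (R u' (B b c)) u l
    have h3 : B l (R u' (B b c)) = -B u' (R l (B b c)) := H.skew _ _ _
    rw [h3, map_neg, add_assoc] at h1
    rw [eq_neg_of_add_eq_zero_left h1]
    refine Submodule.neg_mem _ (Submodule.add_mem _ (Submodule.neg_mem _ ?_) ?_)
    · exact ih (hl b c) u' u
    · exact hl _ _

theorem mul_annih_annih (H : IsPeircePair B R) {k : ℕ} {l l' : U}
    (hl : l ∈ annih B R (k + 1)) (hl' : l' ∈ annih B R (k + 1)) (u : U) :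
    R u (B l l') ∈ annih B R k := by
  have h := H.cyclic u l l'
  rw [add_assoc] at h
  rw [eq_neg_of_add_eq_zero_left h]
  exact Submodule.neg_mem _ (Submodule.add_mem _ (mem_annih_succ.mp hl _ _)
    (mem_annih_succ.mp hl' _ _))

theorem annih_three (H : IsPeircePair B R) (h2 : (2 : K) ≠ 0) (u : U) : u ∈ annih B R 3 := by
  simp only [mem_annih_succ]
  intro b b' c c' d d'
  rw [mem_annih_zero]
  exact fun h => H.mul_mul_mul h2 _ _ _ _ _ _ _ _

end IsPeircePair

/-! ### Peirce decomposition and the identities of a Bernstein algebra -/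

section Peirce

variable {K : Type u} [Field K]

/-- Linear functionals reduce the claim to scalar polynomials, which vanish identically because `K`
is infinite. All linearizations of the Bernstein identity pass through this lemma. -/
theorem coeff_eq_zero [Infinite K] {M : Type*} [AddCommGroup M] [Module K M]
    {m₀ m₁ m₂ m₃ m₄ : M}
    (h : ∀ t : K, m₀ + t • m₁ + t ^ 2 • m₂ + t ^ 3 • m₃ + t ^ 4 • m₄ = 0) :
    m₁ = 0 ∧ m₂ = 0 ∧ m₃ = 0 ∧ m₄ = 0 := by
  open Polynomial in
  have key : ∀ φ : Module.Dual K M, φ m₁ = 0 ∧ φ m₂ = 0 ∧ φ m₃ = 0 ∧ φ m₄ = 0 := by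
    intro φ
    have hp : (C (φ m₀) + C (φ m₁) * X + C (φ m₂) * X ^ 2 + C (φ m₃) * X ^ 3
        + C (φ m₄) * X ^ 4 : K[X]) = 0 := by
      refine Polynomial.funext fun t => ?_
      have ht := congrArg φ (h t)
      simp only [map_add, map_smul, smul_eq_mul, map_zero] at ht
      simp only [eval_add, eval_mul, eval_C, eval_X, eval_pow, eval_zero]
      rw [← ht]
      ring
    refine ⟨?_, ?_, ?_, ?_⟩
    · simpa [coeff_X, coeff_C, coeff_X_pow] using congrArg (fun p => coeff p 1) hp
    · simpa [coeff_X, coeff_C, coeff_X_pow] using congrArg (fun p => coeff p 2) hp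
    · simpa [coeff_X, coeff_C, coeff_X_pow] using congrArg (fun p => coeff p 3) hp
    · simpa [coeff_X, coeff_C, coeff_X_pow] using congrArg (fun p => coeff p 4) hp
  refine ⟨?_, ?_, ?_, ?_⟩ <;> rw [← Module.forall_dual_apply_eq_zero_iff K] <;> intro φ
  exacts [(key φ).1, (key φ).2.1, (key φ).2.2.1, (key φ).2.2.2]

variable {A : Type v} [NonUnitalNonAssocCommRing A] [Module K A] [IsScalarTower K A A]
  [SMulCommClass K A A] {ω : A →ₙₐ[K] K} {e : A}

theorem IsBernstein.exists_idempotent (h : IsBernstein ω) : ∃ e : A, e * e = e ∧ ω e = 1 := by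
  obtain ⟨x, hx⟩ : ∃ x, ω x ≠ 0 := by
    by_contra! hc
    exact h.weight_ne_zero (NonUnitalAlgHom.ext hc)
  have hy : ω ((ω x)⁻¹ • x) = 1 := by simp [hx]
  set y := (ω x)⁻¹ • x
  refine ⟨y * y, ?_, by simp [hy]⟩
  rw [h.sq_sq, hy, one_pow, one_smul]

/-- These are the coefficients of `t`, `t²`, `t³`, `t⁴` in the Bernstein identity at `e + t • n`, an
element of weight 1. -/
theorem IsBernstein.idempotent_identities [Infinite K] (h2 : (2 : K) ≠ 0) (h : IsBernstein ω)
    (he : e * e = e) (hωe : ω e = 1) {n : A} (hn : ω n = 0) :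
    (2 : K) • (e * (e * n)) = e * n ∧
    (2 : K) • (e * (n * n)) + (4 : K) • ((e * n) * (e * n)) = n * n ∧
    (e * n) * (n * n) = 0 ∧ (n * n) * (n * n) = 0 := by
  have key : ∀ t : K, (0 : A) + t • ((4 : K) • (e * (e * n)) - (2 : K) • (e * n))
      + t ^ 2 • ((2 : K) • (e * (n * n)) + (4 : K) • ((e * n) * (e * n)) - n * n)
      + t ^ 3 • ((4 : K) • ((e * n) * (n * n))) + t ^ 4 • ((n * n) * (n * n)) = 0 := by
    intro t
    have hsq : (e + t • n) * (e + t • n) = e + t • (2 : K) • (e * n) + t ^ 2 • (n * n) := by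
      simp only [mul_add, add_mul, smul_mul_assoc, mul_smul_comm, he, mul_comm n e]
      module
    have h1 := h.sq_sq (e + t • n)
    have hω : ω (e + t • n) = 1 := by simp [hn, hωe]
    rw [hsq, hω, one_pow, one_smul] at h1
    generalize hp : e * n = p at *
    generalize hq : n * n = q at *
    rw [← sub_eq_zero] at h1
    refine Eq.trans ?_ h1
    simp only [mul_add, add_mul, smul_mul_assoc, mul_smul_comm, he, mul_comm p e, mul_comm q e,
      mul_comm q p]
    module
  obtain ⟨k1, k2, k3, k4⟩ := coeff_eq_zero key
  have h4 : (4 : K) ≠ 0 := by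
    rw [show (4 : K) = 2 * 2 by norm_num]
    exact mul_ne_zero h2 h2
  refine ⟨?_, sub_eq_zero.mp k2, (smul_eq_zero.mp k3).resolve_left h4, k4⟩
  have k5 : (2 : K) • ((2 : K) • (e * (e * n)) - e * n) = 0 := by rw [← k1]; module
  exact sub_eq_zero.mp ((smul_eq_zero.mp k5).resolve_left h2)

/-- Left multiplication by `e` on a product of two elements of weight zero. -/
theorem IsBernstein.idempotent_mul_mul [Infinite K] (h2 : (2 : K) ≠ 0) (h : IsBernstein ω)
    (he : e * e = e) (hωe : ω e = 1) {x y : A} (hx : ω x = 0) (hy : ω y = 0) :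
    (2 : K) • (e * (x * y)) + (4 : K) • ((e * x) * (e * y)) = x * y := by
  have h1 := (h.idempotent_identities h2 he hωe (n := x + y) (by simp [hx, hy])).2.1
  have hx' := (h.idempotent_identities h2 he hωe hx).2.1
  have hy' := (h.idempotent_identities h2 he hωe hy).2.1
  simp only [mul_add, add_mul, mul_comm y x, mul_comm (e * y) (e * x)] at h1
  have : (2 : K) • ((2 : K) • (e * (x * y)) + (4 : K) • ((e * x) * (e * y)) - x * y) = 0 := by
    linear_combination (norm := module) h1 - hx' - hy'
  exact sub_eq_zero.mp ((smul_eq_zero.mp this).resolve_left h2)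

variable (K) in
/-- The Peirce component of an idempotent `e` for the eigenvalue `1 / 2`. -/
def peirceHalf (e : A) : Submodule K A where
  carrier := {x | (2 : K) • (e * x) = x}
  add_mem' := by
    intro a b ha hb
    simp only [Set.mem_ofPred_eq] at *
    rw [mul_add, smul_add, ha, hb]
  zero_mem' := by simp
  smul_mem' := by
    intro c x hx
    simp only [Set.mem_ofPred_eq] at *
    rw [mul_smul_comm, smul_comm, hx]

/-- The Peirce component of an idempotent `e` for the eigenvalue `0`. -/
def peirceZero (ω : A →ₙₐ[K] K) (e : A) : Submodule K A where
  carrier := {x | ω x = 0 ∧ e * x = 0}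
  add_mem' := by
    rintro a b ⟨ha, ha'⟩ ⟨hb, hb'⟩
    simp [ha, hb, mul_add, ha', hb']
  zero_mem' := by simp
  smul_mem' := by
    rintro c x ⟨hx, hx'⟩
    exact ⟨by simp [hx], by rw [mul_smul_comm, hx', smul_zero]⟩

theorem mem_peirceHalf {x : A} : x ∈ peirceHalf K e ↔ (2 : K) • (e * x) = x := Iff.rfl

theorem weight_of_mem_peirceHalf (hωe : ω e = 1) {x : A} (hx : x ∈ peirceHalf K e) :
    ω x = 0 := by
  have h := congrArg ω (mem_peirceHalf.mp hx)
  rw [map_smul, map_mul, hωe, one_mul, smul_eq_mul] at h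
  linear_combination h

theorem idempotent_mul_of_mem_peirceHalf (h2 : (2 : K) ≠ 0) {x : A} (hx : x ∈ peirceHalf K e) :
    e * x = (2 : K)⁻¹ • x := by
  rw [eq_inv_smul_iff₀ h2]
  exact hx

/-- The identities between the Peirce components of a Bernstein algebra. -/
structure PeirceRules (ω : A →ₙₐ[K] K) (e : A) : Prop where
  half_mul_half : ∀ {x y}, x ∈ peirceHalf K e → y ∈ peirceHalf K e → x * y ∈ peirceZero ω e
  half_mul_zero : ∀ {x y}, x ∈ peirceHalf K e → y ∈ peirceZero ω e → x * y ∈ peirceHalf K e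
  zero_mul_zero : ∀ {x y}, x ∈ peirceZero ω e → y ∈ peirceZero ω e → x * y ∈ peirceHalf K e
  half_mul_sq : ∀ {u v}, u ∈ peirceHalf K e → v ∈ peirceZero ω e → u * (v * v) = 0
  skew : ∀ {u v}, u ∈ peirceHalf K e → v ∈ peirceZero ω e → u * (u * v) = 0
  cyclic : ∀ {a b c}, a ∈ peirceHalf K e → b ∈ peirceHalf K e → c ∈ peirceHalf K e →
    a * (b * c) + b * (c * a) + c * (a * b) = 0
  mul_sq : ∀ {u v}, u ∈ peirceHalf K e → v ∈ peirceZero ω e → (u * v) * (u * v) = 0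

/-- The placement of products is the polarized `t²` identity evaluated on eigenvectors. The identity
`(e * n) * (n * n) = 0` gives `u³ = 0` on `U`, whose polarization is the cyclic rule; at `n = u + t
• v` it also gives `u * (u * v) = 0` and `u * (v * v) = 0`. The last rule is the `t²` coefficient of
`(n * n) * (n * n) = 0` at `n = u + t • v`. -/
theorem IsBernstein.peirceRules [Infinite K] (h2 : (2 : K) ≠ 0) (h : IsBernstein ω)
    (he : e * e = e) (hωe : ω e = 1) : PeirceRules ω e := by
  have hw : ∀ {x : A}, x ∈ peirceHalf K e → ω x = 0 := weight_of_mem_peirceHalf hωe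
  have hh : ∀ {x : A}, x ∈ peirceHalf K e → e * x = (2 : K)⁻¹ • x :=
    idempotent_mul_of_mem_peirceHalf h2
  have hm : ∀ {x y : A}, ω x = 0 → ω y = 0 →
      (2 : K) • (e * (x * y)) + (4 : K) • ((e * x) * (e * y)) = x * y :=
    h.idempotent_mul_mul h2 he hωe
  have hz : ∀ {x y}, x ∈ peirceZero ω e → y ∈ peirceZero ω e → x * y ∈ peirceHalf K e := by
    intro x y hx hy
    have h1 := hm hx.1 hy.1
    rw [hx.2, hy.2, mul_zero, smul_zero, add_zero] at h1
    exact h1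
  have cube : ∀ {u : A}, u ∈ peirceHalf K e → u * (u * u) = 0 := by
    intro u hu
    have h1 := (h.idempotent_identities h2 he hωe (hw hu)).2.2.1
    rw [hh hu, smul_mul_assoc] at h1
    exact (smul_eq_zero.mp h1).resolve_left (inv_ne_zero h2)
  have mixed : ∀ {u v}, u ∈ peirceHalf K e → v ∈ peirceZero ω e →
      u * (u * v) = 0 ∧ u * (v * v) = 0 := by
    intro u v hu hv
    have key : ∀ t : K, (0 : A) + t • ((2 : K) • (u * (u * v))) + t ^ 2 • (u * (v * v))
        + t ^ 3 • (0 : A) + t ^ 4 • (0 : A) = 0 := by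
      intro t
      have h1 := (h.idempotent_identities h2 he hωe (n := u + t • v)
        (by simp [hw hu, hv.1])).2.2.1
      rw [mul_add, mul_smul_comm, hv.2, smul_zero, add_zero, hh hu, smul_mul_assoc] at h1
      have h3 := (smul_eq_zero.mp h1).resolve_left (inv_ne_zero h2)
      simp only [mul_add, add_mul, smul_mul_assoc, mul_smul_comm, mul_comm v u, cube hu] at h3
      refine Eq.trans ?_ h3
      module
    obtain ⟨k1, k2, -, -⟩ := coeff_eq_zero key
    exact ⟨(smul_eq_zero.mp k1).resolve_left h2, k2⟩
  have cyc : ∀ {a b c}, a ∈ peirceHalf K e → b ∈ peirceHalf K e → c ∈ peirceHalf K e →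
      a * (b * c) + b * (c * a) + c * (a * b) = 0 := by
    have lin : ∀ {u w}, u ∈ peirceHalf K e → w ∈ peirceHalf K e →
        w * (u * u) + (2 : K) • (u * (u * w)) = 0 := by
      intro u w hu hw'
      have key : ∀ t : K, (0 : A) + t • (w * (u * u) + (2 : K) • (u * (u * w)))
          + t ^ 2 • (u * (w * w) + (2 : K) • (w * (u * w)))
          + t ^ 3 • (0 : A) + t ^ 4 • (0 : A) = 0 := by
        intro t
        have h1 := cube (Submodule.add_mem _ hu (Submodule.smul_mem _ t hw'))
        simp only [mul_add, add_mul, smul_mul_assoc, mul_smul_comm, mul_comm w u, cube hu,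
          cube hw'] at h1
        refine Eq.trans ?_ h1
        module
      exact (coeff_eq_zero key).1
    intro a b c ha hb hc
    have h1 := lin (Submodule.add_mem _ ha hb) hc
    have ha' := lin ha hc
    have hb' := lin hb hc
    simp only [mul_add, add_mul, smul_add, mul_comm b a] at h1
    have : (2 : K) • (a * (b * c) + b * (c * a) + c * (a * b)) = 0 := by
      rw [mul_comm c a]
      linear_combination (norm := module) h1 - ha' - hb'
    exact (smul_eq_zero.mp this).resolve_left h2
  refine ⟨?_, ?_, hz, fun hu hv => (mixed hu hv).2, fun hu hv => (mixed hu hv).1, cyc, ?_⟩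
  · intro x y hx hy
    refine ⟨by simp [hw hx], ?_⟩
    have h1 := hm (hw hx) (hw hy)
    rw [hh hx, hh hy, smul_mul_assoc, mul_smul_comm, smul_smul, smul_smul,
      show (4 : K) * 2⁻¹ * 2⁻¹ = 1 by field_simp; norm_num, one_smul, add_eq_right] at h1
    exact (smul_eq_zero.mp h1).resolve_left h2
  · intro x y hx hy
    have h1 := hm (hw hx) hy.1
    rw [hy.2, mul_zero, smul_zero, add_zero] at h1
    exact h1
  · intro u v hu hv
    -- Since `v * v` lies in `U` and is annihilated by `u`, the cyclic rule for `u, u, v * v` leaves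
    -- only this term.
    have h0 : (u * u) * (v * v) = 0 := by
      have h1 := cyc hu hu (hz hv hv)
      rw [mul_comm (v * v) u, (mixed hu hv).2, mul_zero, zero_add, zero_add] at h1
      rw [mul_comm]
      exact h1
    have key : ∀ t : K, (0 : A) + t • ((4 : K) • ((u * u) * (u * v)))
        + t ^ 2 • ((4 : K) • ((u * v) * (u * v)))
        + t ^ 3 • ((4 : K) • ((u * v) * (v * v))) + t ^ 4 • (0 : A) = 0 := by
      intro t
      have h1 := (h.idempotent_identities h2 he hωe (n := u + t • v)
        (by simp [hw hu, hv.1])).2.2.2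
      have hu4 := (h.idempotent_identities h2 he hωe (hw hu)).2.2.2
      have hv4 := (h.idempotent_identities h2 he hωe hv.1).2.2.2
      simp only [mul_add, add_mul, smul_mul_assoc, mul_smul_comm, mul_comm v u, hu4, hv4,
        mul_comm (v * v) (u * u), mul_comm (u * v) (u * u), mul_comm (v * v) (u * v), h0] at h1
      refine Eq.trans ?_ h1
      module
    have h4 : (4 : K) ≠ 0 := by
      rw [show (4 : K) = 2 * 2 by norm_num]
      exact mul_ne_zero h2 h2
    exact (smul_eq_zero.mp (coeff_eq_zero key).2.1).resolve_left h4

end Peirce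

/-! ### A chain of ideals showing that the barideal is solvable -/

section Chain

variable {K : Type u} [Field K] {A : Type v} [NonUnitalNonAssocCommRing A] [Module K A]
  [IsScalarTower K A A] [SMulCommClass K A A] {ω : A →ₙₐ[K] K} {e : A}

theorem isIdeal_of_mul_mem {I : Submodule K A} (h : ∀ a : A, ∀ x ∈ I, a * x ∈ I) : IsIdeal I :=
  fun a x hx => ⟨h a x hx, mul_comm a x ▸ h a x hx⟩

/-- The Peirce decomposition. -/
theorem IsBernstein.exists_peirce [Infinite K] (h2 : (2 : K) ≠ 0) (h : IsBernstein ω)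
    (he : e * e = e) (hωe : ω e = 1) (a : A) :
    ∃ u ∈ peirceHalf K e, ∃ v ∈ peirceZero ω e, a = ω a • e + (u + v) := by
  set n := a - ω a • e with hn
  have hωn : ω n = 0 := by simp [hn, hωe]
  have h1 := (h.idempotent_identities h2 he hωe hωn).1
  -- Because `2 e (e n) = e n`, twice the multiplication by `e` is a projection of `N` onto `U`.
  refine ⟨(2 : K) • (e * n), ?_, n - (2 : K) • (e * n), ⟨?_, ?_⟩, ?_⟩
  · rw [mem_peirceHalf, mul_smul_comm, h1]
  · simp [hωn]
  · rw [mul_sub, mul_smul_comm, h1, sub_self]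
  · rw [add_sub_cancel, hn, add_sub_cancel]

theorem IsBernstein.exists_peirce_of_weight [Infinite K] (h2 : (2 : K) ≠ 0) (h : IsBernstein ω)
    (he : e * e = e) (hωe : ω e = 1) {n : A} (hn : ω n = 0) :
    ∃ u ∈ peirceHalf K e, ∃ v ∈ peirceZero ω e, n = u + v := by
  obtain ⟨u, hu, v, hv, h⟩ := h.exists_peirce h2 he hωe n
  exact ⟨u, hu, v, hv, by rw [h, hn, zero_smul, zero_add]⟩

namespace PeirceRules

/-- The product `U × U → V` of the Peirce components. -/
def mulHalf (H : PeirceRules ω e) :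
    peirceHalf K e →ₗ[K] peirceHalf K e →ₗ[K] peirceZero ω e :=
  LinearMap.mk₂ K (fun x y => ⟨x * y, H.half_mul_half x.2 y.2⟩)
    (fun _ _ _ => Subtype.ext (add_mul _ _ _)) (fun _ _ _ => Subtype.ext (smul_mul_assoc _ _ _))
    (fun _ _ _ => Subtype.ext (mul_add _ _ _)) (fun _ _ _ => Subtype.ext (mul_smul_comm _ _ _))

/-- The product `U × V → U` of the Peirce components. -/
def mulZero (H : PeirceRules ω e) :
    peirceHalf K e →ₗ[K] peirceZero ω e →ₗ[K] peirceHalf K e :=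
  LinearMap.mk₂ K (fun x y => ⟨x * y, H.half_mul_zero x.2 y.2⟩)
    (fun _ _ _ => Subtype.ext (add_mul _ _ _)) (fun _ _ _ => Subtype.ext (smul_mul_assoc _ _ _))
    (fun _ _ _ => Subtype.ext (mul_add _ _ _)) (fun _ _ _ => Subtype.ext (mul_smul_comm _ _ _))

theorem isPeircePair (H : PeirceRules ω e) : IsPeircePair H.mulHalf H.mulZero where
  comm a b := Subtype.ext (mul_comm _ _)
  cyclic a b c := Subtype.ext (H.cyclic a.2 b.2 c.2)
  skew a b v := by
    refine Subtype.ext ?_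
    change (a : A) * (b * v) = -((b : A) * (a * v))
    have h := H.skew (Submodule.add_mem _ a.2 b.2) v.2
    simp only [add_mul, mul_add, H.skew a.2 v.2, H.skew b.2 v.2, zero_add, add_zero] at h
    exact eq_neg_of_add_eq_zero_right h
  mul_self a v := Subtype.ext (H.mul_sq a.2 v.2)

/-- The iterated annihilators in `U`, as subspaces of `A`. -/
def annih (H : PeirceRules ω e) (k : ℕ) : Submodule K A :=
  (IsPeircePair.annih H.mulHalf H.mulZero k).map (peirceHalf K e).subtype

theorem annih_le (H : PeirceRules ω e) (k : ℕ) : H.annih k ≤ peirceHalf K e := by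
  rintro _ ⟨x, -, rfl⟩
  exact x.2

theorem annih_zero_le (H : PeirceRules ω e) (k : ℕ) : H.annih 0 ≤ H.annih k :=
  Submodule.map_mono (H.isPeircePair.annih_zero_le k)

theorem annih_le_succ (H : PeirceRules ω e) (k : ℕ) : H.annih k ≤ H.annih (k + 1) :=
  Submodule.map_mono (H.isPeircePair.annih_le_succ k)

theorem le_annih_three (H : PeirceRules ω e) (h2 : (2 : K) ≠ 0) :
    peirceHalf K e ≤ H.annih 3 :=
  fun u hu => ⟨⟨u, hu⟩, H.isPeircePair.annih_three h2 _, rfl⟩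

theorem annih_mul (H : PeirceRules ω e) (h2 : (2 : K) ≠ 0) {k : ℕ} {l v : A}
    (hl : l ∈ H.annih k) (hv : v ∈ peirceZero ω e) : l * v ∈ H.annih k := by
  obtain ⟨l, hl, rfl⟩ := hl
  exact ⟨_, H.isPeircePair.annih_mul h2 k hl ⟨v, hv⟩, rfl⟩

theorem mul_mul_annih (H : PeirceRules ω e) (h2 : (2 : K) ≠ 0) {k : ℕ} {l u u' : A}
    (hl : l ∈ H.annih k) (hu : u ∈ peirceHalf K e) (hu' : u' ∈ peirceHalf K e) :
    u' * (u * l) ∈ H.annih k := by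
  obtain ⟨l, hl, rfl⟩ := hl
  exact ⟨_, H.isPeircePair.mul_mul_annih h2 k hl ⟨u, hu⟩ ⟨u', hu'⟩, rfl⟩

theorem mul_annih_annih (H : PeirceRules ω e) {k : ℕ} {l l' u : A}
    (hl : l ∈ H.annih (k + 1)) (hl' : l' ∈ H.annih (k + 1)) (hu : u ∈ peirceHalf K e) :
    u * (l * l') ∈ H.annih k := by
  obtain ⟨l, hl, rfl⟩ := hl
  obtain ⟨l', hl', rfl⟩ := hl'
  exact ⟨_, H.isPeircePair.mul_annih_annih hl hl' ⟨u, hu⟩, rfl⟩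

theorem annih_zero_mul (H : PeirceRules ω e) {l u : A}
    (hl : l ∈ H.annih 0) (hu : u ∈ peirceHalf K e) : l * u = 0 := by
  obtain ⟨l, hl, rfl⟩ := hl
  exact congrArg Subtype.val (IsPeircePair.mem_annih_zero.mp hl ⟨u, hu⟩)

variable (K) in
/-- The square of the Peirce component `U`. -/
def halfSq (e : A) : Submodule K A :=
  Submodule.map₂ (LinearMap.mul K A) (peirceHalf K e) (peirceHalf K e)

theorem mul_mem_halfSq {x y : A} (hx : x ∈ peirceHalf K e) (hy : y ∈ peirceHalf K e) :
    x * y ∈ halfSq K e :=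
  Submodule.apply_mem_map₂ _ hx hy

theorem halfSq_le (H : PeirceRules ω e) : halfSq K e ≤ peirceZero ω e :=
  Submodule.map₂_le.mpr fun _ hx _ hy => H.half_mul_half hx hy

theorem annih_succ_mul (H : PeirceRules ω e) {k : ℕ} {l w : A}
    (hl : l ∈ H.annih (k + 1)) (hw : w ∈ halfSq K e) : l * w ∈ H.annih k := by
  suffices halfSq K e ≤ (H.annih k).comap (LinearMap.mul K A l) from this hw
  obtain ⟨l, hl, rfl⟩ := hl
  exact Submodule.map₂_le.mpr fun x hx y hy =>
    ⟨_, IsPeircePair.mem_annih_succ.mp hl ⟨x, hx⟩ ⟨y, hy⟩, rfl⟩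

theorem annih_zero_mul_halfSq (H : PeirceRules ω e) {l w : A}
    (hl : l ∈ H.annih 0) (hw : w ∈ halfSq K e) : l * w = 0 := by
  suffices halfSq K e ≤ LinearMap.ker (LinearMap.mul K A l) from this hw
  refine Submodule.map₂_le.mpr fun x hx y hy => ?_
  have h := H.cyclic (H.annih_le 0 hl) hx hy
  rw [mul_comm y l, H.annih_zero_mul hl hx, H.annih_zero_mul hl hy, mul_zero, mul_zero, add_zero,
    add_zero] at h
  exact h

/-- Polarization of `u * (v * v) = 0`: products of two elements of `V` annihilate `U`, so they are
harmless in every ideal of the chain. -/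
theorem zero_mul_zero_mem (H : PeirceRules ω e) (h2 : (2 : K) ≠ 0) {v w : A}
    (hv : v ∈ peirceZero ω e) (hw : w ∈ peirceZero ω e) : v * w ∈ H.annih 0 := by
  refine ⟨⟨v * w, H.zero_mul_zero hv hw⟩, IsPeircePair.mem_annih_zero.mpr fun u => ?_, rfl⟩
  refine Subtype.ext ?_
  change v * w * u = 0
  have h := H.half_mul_sq u.2 (Submodule.add_mem _ hv hw)
  simp only [mul_add, add_mul, H.half_mul_sq u.2 hv, H.half_mul_sq u.2 hw, zero_add, add_zero,
    mul_comm w v] at h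
  rw [mul_comm]
  exact IsPeircePair.eq_zero_of_add_self h2 h

/-- The elements of `U * U` that multiply `U` into the `k`-th iterated annihilator. -/
def zeroPart (H : PeirceRules ω e) (k : ℕ) : Submodule K A where
  carrier := {v | v ∈ halfSq K e ∧ ∀ u ∈ peirceHalf K e, u * v ∈ H.annih k}
  add_mem' := by
    rintro x y ⟨hx, hx'⟩ ⟨hy, hy'⟩
    refine ⟨Submodule.add_mem _ hx hy, fun u hu => ?_⟩
    rw [mul_add]
    exact Submodule.add_mem _ (hx' u hu) (hy' u hu)
  zero_mem' := ⟨Submodule.zero_mem _, fun u _ => by rw [mul_zero]; exact Submodule.zero_mem _⟩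
  smul_mem' := by
    rintro c x ⟨hx, hx'⟩
    refine ⟨Submodule.smul_mem _ c hx, fun u hu => ?_⟩
    rw [mul_smul_comm]
    exact Submodule.smul_mem _ c (hx' u hu)

/-- The chain of ideals that witnesses the solvability of the barideal. -/
def chain (H : PeirceRules ω e) (k : ℕ) : Submodule K A := H.annih k ⊔ H.zeroPart k

variable [Infinite K]

theorem chain_isIdeal (H : PeirceRules ω e) (h2 : (2 : K) ≠ 0) (h : IsBernstein ω)
    (he : e * e = e) (hωe : ω e = 1) (k : ℕ) : IsIdeal (H.chain k) := by
  refine isIdeal_of_mul_mem fun a x hx => ?_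
  obtain ⟨l, hl, w, ⟨hw, hw'⟩, rfl⟩ := Submodule.mem_sup.mp hx
  obtain ⟨u, hu, v, hv, ha⟩ := h.exists_peirce h2 he hωe a
  have hL : ∀ {y}, y ∈ H.annih k → y ∈ H.chain k := fun hy => Submodule.mem_sup_left hy
  rw [ha]
  simp only [add_mul, mul_add, smul_mul_assoc]
  refine Submodule.add_mem _ (Submodule.add_mem _ ?_ (Submodule.add_mem _ ?_ ?_))
    (Submodule.add_mem _ ?_ (Submodule.add_mem _ ?_ ?_))
  · rw [idempotent_mul_of_mem_peirceHalf h2 (H.annih_le k hl)]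
    exact Submodule.smul_mem _ _ (Submodule.smul_mem _ _ (hL hl))
  · exact Submodule.mem_sup_right ⟨mul_mem_halfSq hu (H.annih_le k hl),
      fun u' hu' => H.mul_mul_annih h2 hl hu hu'⟩
  · rw [mul_comm]
    exact hL (H.annih_mul h2 hl hv)
  · rw [(H.halfSq_le hw).2, smul_zero]
    exact Submodule.zero_mem _
  · exact hL (hw' u hu)
  · exact hL (H.annih_zero_le k (H.zero_mul_zero_mem h2 hv (H.halfSq_le hw)))

theorem annih_zero_isIdeal (H : PeirceRules ω e) (h2 : (2 : K) ≠ 0) (h : IsBernstein ω)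
    (he : e * e = e) (hωe : ω e = 1) : IsIdeal (H.annih 0) := by
  refine isIdeal_of_mul_mem fun a l hl => ?_
  obtain ⟨u, hu, v, hv, ha⟩ := h.exists_peirce h2 he hωe a
  rw [ha]
  simp only [add_mul, smul_mul_assoc]
  refine Submodule.add_mem _ ?_ (Submodule.add_mem _ ?_ ?_)
  · rw [idempotent_mul_of_mem_peirceHalf h2 (H.annih_le 0 hl)]
    exact Submodule.smul_mem _ _ (Submodule.smul_mem _ _ hl)
  · rw [mul_comm, H.annih_zero_mul hl hu]
    exact Submodule.zero_mem _
  · rw [mul_comm]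
    exact H.annih_mul h2 hl hv

theorem chain_le_succ (H : PeirceRules ω e) (k : ℕ) : H.chain k ≤ H.chain (k + 1) :=
  sup_le_sup (H.annih_le_succ k) fun _ hx => ⟨hx.1, fun u hu => H.annih_le_succ k (hx.2 u hu)⟩

theorem weight_of_mem_chain (H : PeirceRules ω e) (hωe : ω e = 1) {k : ℕ} {x : A}
    (hx : x ∈ H.chain k) : ω x = 0 := by
  obtain ⟨l, hl, w, ⟨hw, -⟩, rfl⟩ := Submodule.mem_sup.mp hx
  rw [map_add, weight_of_mem_peirceHalf hωe (H.annih_le k hl), (H.halfSq_le hw).1, add_zero]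

/-- Products within `annih (k + 1)` fall into `zeroPart k` by the cyclic rule. Mixed products drop
to `annih k` because `zeroPart` is confined to `U * U`, whose elements lower the annihilator level.
-/
theorem chain_succ_mul (H : PeirceRules ω e) (h2 : (2 : K) ≠ 0) {k : ℕ} {x y : A}
    (hx : x ∈ H.chain (k + 1)) (hy : y ∈ H.chain (k + 1)) : x * y ∈ H.chain k := by
  obtain ⟨l, hl, w, ⟨hw, -⟩, rfl⟩ := Submodule.mem_sup.mp hx
  obtain ⟨l', hl', w', ⟨hw', -⟩, rfl⟩ := Submodule.mem_sup.mp hy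
  have hL : ∀ {y}, y ∈ H.annih k → y ∈ H.chain k := fun hy => Submodule.mem_sup_left hy
  simp only [add_mul, mul_add]
  refine Submodule.add_mem _ (Submodule.add_mem _ ?_ ?_) (Submodule.add_mem _ ?_ ?_)
  · exact Submodule.mem_sup_right ⟨mul_mem_halfSq (H.annih_le _ hl) (H.annih_le _ hl'),
      fun u hu => H.mul_annih_annih hl hl' hu⟩
  · rw [mul_comm]
    exact hL (H.annih_succ_mul hl' hw)
  · exact hL (H.annih_succ_mul hl hw')
  · exact hL (H.annih_zero_le k (H.zero_mul_zero_mem h2 (H.halfSq_le hw) (H.halfSq_le hw')))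

theorem chain_zero_mul (H : PeirceRules ω e) (h2 : (2 : K) ≠ 0) {x y : A}
    (hx : x ∈ H.chain 0) (hy : y ∈ H.chain 0) : x * y ∈ H.annih 0 := by
  obtain ⟨l, hl, w, ⟨hw, -⟩, rfl⟩ := Submodule.mem_sup.mp hx
  obtain ⟨l', hl', w', ⟨hw', -⟩, rfl⟩ := Submodule.mem_sup.mp hy
  rw [add_mul, mul_add, mul_add, H.annih_zero_mul hl (H.annih_le 0 hl'), mul_comm w l',
    H.annih_zero_mul_halfSq hl hw', H.annih_zero_mul_halfSq hl' hw, zero_add, zero_add, zero_add]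
  exact H.zero_mul_zero_mem h2 (H.halfSq_le hw) (H.halfSq_le hw')

/-- Since `annih 3` is all of `U`, `chain 3` is `U + U * U`, and every product in `N` lies there. -/
theorem mul_mem_chain_three (H : PeirceRules ω e) (h2 : (2 : K) ≠ 0) (h : IsBernstein ω)
    (he : e * e = e) (hωe : ω e = 1) {x y : A} (hx : ω x = 0) (hy : ω y = 0) :
    x * y ∈ H.chain 3 := by
  obtain ⟨u, hu, v, hv, rfl⟩ := h.exists_peirce_of_weight h2 he hωe hx
  obtain ⟨u', hu', v', hv', rfl⟩ := h.exists_peirce_of_weight h2 he hωe hy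
  have hL : ∀ {y}, y ∈ peirceHalf K e → y ∈ H.chain 3 :=
    fun hy => Submodule.mem_sup_left (H.le_annih_three h2 hy)
  simp only [add_mul, mul_add]
  refine Submodule.add_mem _ (Submodule.add_mem _ ?_ ?_) (Submodule.add_mem _ ?_ ?_)
  · exact Submodule.mem_sup_right ⟨mul_mem_halfSq hu hu', fun w hw =>
      H.le_annih_three h2 (H.half_mul_zero hw (H.half_mul_half hu hu'))⟩
  · rw [mul_comm]
    exact hL (H.half_mul_zero hu' hv)
  · exact hL (H.half_mul_zero hu hv')
  · exact hL (H.zero_mul_zero hv hv')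

end PeirceRules

end Chain

/-! ### Finitely generated nilpotent algebras -/

section Nilpotent

variable {K : Type u} [Field K] {A : Type v} [NonUnitalNonAssocRing A] [Module K A]
  [IsScalarTower K A A] [SMulCommClass K A A]

theorem power_one : power K A 1 = ⊤ := by rw [power]

theorem power_succ_succ (n : ℕ) : power K A (n + 2) = ⨆ i : Fin (n + 1),
    Submodule.map₂ (LinearMap.mul K A) (power K A (i.1 + 1)) (power K A (n + 1 - i.1)) := by
  rw [power]

theorem mul_mem_power_left {k : ℕ} {x : A} (hx : x ∈ power K A (k + 1)) (y : A) :
    x * y ∈ power K A (k + 2) := by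
  rw [power_succ_succ]
  refine Submodule.mem_iSup_of_mem (Fin.last k) (Submodule.apply_mem_map₂ _ (by simpa using hx) ?_)
  simp [power_one]

theorem mul_mem_power_right {k : ℕ} {y : A} (hy : y ∈ power K A (k + 1)) (x : A) :
    x * y ∈ power K A (k + 2) := by
  rw [power_succ_succ]
  refine Submodule.mem_iSup_of_mem 0 (Submodule.apply_mem_map₂ _ ?_ (by simpa using hy))
  simp [power_one]

/-- A finitely generated nilpotent algebra is finite-dimensional. -/
theorem IsNilpotentAlgebra.finite_of_adjoin {s : Set A} (hs : s.Finite)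
    (h : IsNilpotentAlgebra K (NonUnitalAlgebra.adjoin K s)) :
    Module.Finite K (NonUnitalAlgebra.adjoin K s) := by
  set S := NonUnitalAlgebra.adjoin K s with hS
  set t : Set S := Subtype.val ⁻¹' s
  have ht : t.Finite := hs.preimage Subtype.val_injective.injOn
  have hspan : ∀ x : S, x ∈ Submodule.span K t ⊔ Submodule.map₂ (LinearMap.mul K S) ⊤ ⊤ := by
    rintro ⟨x, hx⟩
    induction hx using NonUnitalAlgebra.adjoin_induction with
    | mem x hx => exact Submodule.mem_sup_left (Submodule.subset_span hx)
    | add x y hx hy h1 h2 => exact Submodule.add_mem _ h1 h2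
    | zero => exact Submodule.zero_mem _
    | mul x y hx hy h1 h2 =>
      exact Submodule.mem_sup_right (Submodule.apply_mem_map₂ (LinearMap.mul K S)
        (m := ⟨x, hx⟩) (n := ⟨y, hy⟩) Submodule.mem_top Submodule.mem_top)
    | smul r x hx h1 => exact Submodule.smul_mem _ r h1
  -- Modulo each power the algebra is finite-dimensional. Inductively `S` is spanned by the
  -- generators and `S * S`, and substituting `S = D + S^(k+1)` in both factors leaves `D * D` and
  -- terms in `S^(k+2)`.
  have key : ∀ k : ℕ, ∃ D : Submodule K S, D.FG ∧ D ⊔ power K S (k + 1) = ⊤ := by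
    intro k
    induction k with
    | zero => exact ⟨⊥, Submodule.fg_bot, by rw [power_one, sup_top_eq]⟩
    | succ k ih =>
      obtain ⟨D, hD, hD'⟩ := ih
      refine ⟨Submodule.span K t ⊔ Submodule.map₂ (LinearMap.mul K S) D D,
        (Submodule.fg_span ht).sup (hD.map₂ _ hD), ?_⟩
      refine eq_top_iff.mpr fun x _ => ?_
      refine (sup_le ?_ ?_ : Submodule.span K t ⊔ Submodule.map₂ (LinearMap.mul K S) ⊤ ⊤ ≤ _)
        (hspan x)
      · exact le_sup_left.trans le_sup_left
      · refine Submodule.map₂_le.mpr fun x _ y _ => ?_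
        obtain ⟨d, hd, p, hp, rfl⟩ := Submodule.mem_sup.mp (hD' ▸ Submodule.mem_top : x ∈ _)
        obtain ⟨d', hd', p', hp', rfl⟩ := Submodule.mem_sup.mp (hD' ▸ Submodule.mem_top : y ∈ _)
        rw [LinearMap.mul_apply', add_mul, mul_add]
        refine Submodule.add_mem _ (Submodule.add_mem _ ?_ ?_) ?_
        · exact Submodule.mem_sup_left (Submodule.mem_sup_right
            (Submodule.apply_mem_map₂ (LinearMap.mul K S) hd hd'))
        · exact Submodule.mem_sup_right (mul_mem_power_right hp' _)
        · exact Submodule.mem_sup_right (mul_mem_power_left hp _)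
  obtain ⟨n, hn, h⟩ := h
  obtain ⟨D, hD, hD'⟩ := key (n - 1)
  rw [Nat.sub_add_cancel hn, h, sup_bot_eq] at hD'
  exact ⟨hD' ▸ hD⟩

end Nilpotent

/-! ### Noetherian Bernstein algebras are finite-dimensional -/

section Noetherian

variable {K : Type u} [Field K] {A : Type v} [NonUnitalNonAssocCommRing A] [Module K A]

theorem IsNoetherianAlgebra.wellFoundedGT (h : IsNoetherianAlgebra K A) :
    WellFoundedGT {I : Submodule K A // IsIdeal I} := by
  rw [wellFoundedGT_iff_monotone_chain_condition]
  intro f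
  obtain ⟨n, hn⟩ := h (fun i => (f i).1) (fun i => (f i).2) fun i j hij => f.monotone hij
  exact ⟨n, fun m hm => Subtype.ext (hn m hm).symm⟩

variable [IsScalarTower K A A] [SMulCommClass K A A] {ω : A →ₙₐ[K] K} {e : A}

theorem IsLocallyNilpotent.fg_adjoin (h : IsLocallyNilpotent K (barideal ω)) {s : Finset A}
    (hs : ∀ x ∈ s, ω x = 0) : (NonUnitalAlgebra.adjoin K (s : Set A)).toSubmodule.FG := by
  classical
  set t : Finset (barideal ω) := s.attach.image fun x => ⟨x.1, hs x.1 x.2⟩ with ht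
  have hfin : Module.Finite K (NonUnitalAlgebra.adjoin K (t : Set (barideal ω))) :=
    (h t).finite_of_adjoin t.finite_toSet
  have hfg : (NonUnitalAlgebra.adjoin K (t : Set (barideal ω))).toSubmodule.FG :=
    Module.Finite.iff_fg.mp hfin
  set N : Submodule K A := (barideal ω).toSubmodule
  have hmap := hfg.map (R := K) N.subtype
  have hle : (NonUnitalAlgebra.adjoin K (s : Set A)).toSubmodule ≤
      (NonUnitalAlgebra.adjoin K (t : Set (barideal ω))).toSubmodule.map N.subtype := by
    intro x (hx : x ∈ NonUnitalAlgebra.adjoin K (s : Set A))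
    induction hx using NonUnitalAlgebra.adjoin_induction with
    | mem x hx =>
      refine ⟨(⟨x, hs x hx⟩ : barideal ω), NonUnitalAlgebra.subset_adjoin (A := barideal ω) K ?_, rfl⟩
      rw [ht, Finset.coe_image]
      exact ⟨⟨x, hx⟩, Finset.mem_coe.mpr (Finset.mem_attach _ _), rfl⟩
    | add x y hx hy h1 h2 => exact Submodule.add_mem _ h1 h2
    | zero => exact Submodule.zero_mem _
    | mul x y hx hy h1 h2 =>
      obtain ⟨x, hx', rfl⟩ := h1
      obtain ⟨y, hy', rfl⟩ := h2
      exact ⟨(show barideal ω from x) * (show barideal ω from y),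
        (NonUnitalAlgebra.adjoin K (t : Set (barideal ω))).mul_mem hx' hy', rfl⟩
    | smul r x hx h1 => exact Submodule.smul_mem _ r (h1)
  have : Module.Finite K ((NonUnitalAlgebra.adjoin K (t : Set (barideal ω))).toSubmodule.map
      N.subtype) := Module.Finite.iff_fg.mpr hmap
  exact Module.Finite.iff_fg.mp (Submodule.finiteDimensional_of_le hle)

/-- Subalgebras of the barideal with suitable generators are stable under an idempotent. -/
theorem IsBernstein.idempotent_mul_mem_adjoin [Infinite K] (h2 : (2 : K) ≠ 0) (h : IsBernstein ω)
    (he : e * e = e) (hωe : ω e = 1) {s : Set A} (hs : ∀ x ∈ s, ω x = 0) {x : A}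
    (hx : x ∈ NonUnitalAlgebra.adjoin K (s ∪ (e * ·) '' s)) :
    ω x = 0 ∧ e * x ∈ NonUnitalAlgebra.adjoin K (s ∪ (e * ·) '' s) := by
  induction hx using NonUnitalAlgebra.adjoin_induction with
  | mem x hx =>
    rcases hx with hx | ⟨y, hy, rfl⟩
    · exact ⟨hs x hx, NonUnitalAlgebra.subset_adjoin K (Or.inr ⟨x, hx, rfl⟩)⟩
    · refine ⟨by simp [hs y hy], ?_⟩
      have h1 := (h.idempotent_identities h2 he hωe (hs y hy)).1
      refine ((NonUnitalAlgebra.adjoin K _).toSubmodule.smul_mem_iff h2).mp ?_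
      change (2 : K) • (e * (e * y)) ∈ _
      rw [h1]
      exact NonUnitalAlgebra.subset_adjoin K (Or.inr ⟨y, hy, rfl⟩)
  | add x y hx hy h1 h2 =>
    exact ⟨by simp [h1.1, h2.1], by rw [mul_add]; exact add_mem h1.2 h2.2⟩
  | zero => exact ⟨map_zero ω, by rw [mul_zero]; exact zero_mem _⟩
  | mul x y hx hy h1 h3 =>
    refine ⟨by simp [h1.1], ?_⟩
    have h4 := h.idempotent_mul_mul h2 he hωe h1.1 h3.1
    refine ((NonUnitalAlgebra.adjoin K _).toSubmodule.smul_mem_iff h2).mp ?_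
    rw [eq_sub_of_add_eq h4]
    exact Submodule.sub_mem _ ((NonUnitalAlgebra.adjoin K _).mul_mem hx hy)
      (Submodule.smul_mem _ _ ((NonUnitalAlgebra.adjoin K _).mul_mem h1.2 h3.2))
  | smul r x hx h1 =>
    exact ⟨by simp [h1.1], by rw [mul_smul_comm]; exact SMulMemClass.smul_mem r h1.2⟩

/-- In a Noetherian Bernstein algebra with locally nilpotent barideal, finiteness modulo an
ideal `I` of weight zero gives finiteness modulo every smaller ideal that contains the products
of elements of `I`. -/
theorem IsNoetherianAlgebra.fg_sup_eq_top [Infinite K] (h2 : (2 : K) ≠ 0) (h : IsBernstein ω)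
    (hnil : IsLocallyNilpotent K (barideal ω)) (hA : IsNoetherianAlgebra K A)
    (he : e * e = e) (hωe : ω e = 1) {I J : Submodule K A} (hI : IsIdeal I) (hJ : IsIdeal J)
    (hJI : J ≤ I) (hIω : ∀ x ∈ I, ω x = 0) (hmul : ∀ x ∈ I, ∀ y ∈ I, x * y ∈ J)
    (hfin : ∃ D : Submodule K A, D.FG ∧ D ⊔ I = ⊤) :
    ∃ D : Submodule K A, D.FG ∧ D ⊔ J = ⊤ := by
  classical
  obtain ⟨D, ⟨D₀, rfl⟩, hD⟩ := hfin
  let π : A →ₗ[K] A :=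
    { toFun := fun x => x - ω x • e
      map_add' := fun x y => by rw [map_add, add_smul]; abel
      map_smul' := fun c x => by
        rw [map_smul, smul_eq_mul, mul_smul, smul_sub, RingHom.id_apply] }
  have hπ : ∀ x, x = ω x • e + π x := fun x => (add_sub_cancel _ _).symm
  have hωπ : ∀ x, ω (π x) = 0 := fun x => by simp [π, hωe]
  -- Including `e * x` for each generator `x` makes `S T` stable under `e`, while `S T` stays
  -- finitely generated and inside the barideal.
  let S : Finset A → NonUnitalSubalgebra K A := fun T =>
    NonUnitalAlgebra.adjoin K ((T : Set A) ∪ (e * ·) '' (T : Set A))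
  let P : Finset A → Submodule K A := fun T => ((S T).toSubmodule ⊓ I) ⊔ J
  let C : Finset A → Prop := fun T => D₀.image π ⊆ T ∧ ∀ x ∈ T, ω x = 0
  have hPI : ∀ T, P T ≤ I := fun T => sup_le inf_le_right hJI
  have hP : ∀ T, C T → IsIdeal (P T) := by
    rintro T ⟨hT, hTω⟩
    refine isIdeal_of_mul_mem fun a x hx => ?_
    obtain ⟨y, ⟨hyS, hyI⟩, j, hj, rfl⟩ := Submodule.mem_sup.mp hx
    -- The part `i` in `I` multiplies `y` into `J`. The part `d` is a multiple of `e` plus `π d`,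
    -- and `π d` lies in `S T` because `T` contains the projected generators of `D`.
    obtain ⟨d, hd, i, hi, rfl⟩ := Submodule.mem_sup.mp (hD ▸ Submodule.mem_top : a ∈ _)
    rw [mul_add]
    refine Submodule.add_mem _ ?_ (Submodule.mem_sup_right (hJ _ _ hj).1)
    rw [add_mul]
    refine Submodule.add_mem _ ?_ (Submodule.mem_sup_right (hmul i hi y hyI))
    refine Submodule.mem_sup_left ⟨?_, (hI _ _ hyI).1⟩
    have hdS : π d ∈ S T := by
      have h1 : Submodule.span K (D₀ : Set A) ≤ (S T).toSubmodule.comap π :=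
        Submodule.span_le.mpr fun x hx => NonUnitalAlgebra.subset_adjoin K
          (Or.inl (hT (Finset.mem_image_of_mem π hx)))
      exact h1 hd
    rw [hπ d, add_mul, smul_mul_assoc]
    exact Submodule.add_mem _
      (Submodule.smul_mem _ _ (h.idempotent_mul_mem_adjoin h2 he hωe hTω hyS).2)
      ((S T).mul_mem hdS hyS)
  have hC₀ : C (D₀.image π) := by
    refine ⟨subset_rfl, fun x hx => ?_⟩
    obtain ⟨d, -, rfl⟩ := Finset.mem_image.mp hx
    exact hωπ d
  have hwf := hA.wellFoundedGT
  obtain ⟨_, ⟨⟨T, hT⟩, rfl⟩, hmax⟩ := hwf.wf.has_min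
    (Set.range fun T : {T // C T} => (⟨P T.1, hP T.1 T.2⟩ : {I : Submodule K A // IsIdeal I}))
    ⟨_, ⟨⟨_, hC₀⟩, rfl⟩⟩
  -- An element of `I` outside the maximal `P T` could be adjoined to `T`, giving a strictly larger
  -- ideal of the same kind.
  have hPT : P T = I := by
    refine le_antisymm (hPI T) fun x hx => ?_
    have hT' : C (insert x T) := by
      refine ⟨hT.1.trans (Finset.subset_insert _ _), fun y hy => ?_⟩
      rcases Finset.mem_insert.mp hy with rfl | hy
      exacts [hIω y hx, hT.2 y hy]
    have hle : P T ≤ P (insert x T) := by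
      refine sup_le_sup (inf_le_inf ?_ le_rfl) le_rfl
      exact NonUnitalAlgebra.adjoin_mono (Set.union_subset_union
        (by simp) (Set.image_mono (by simp)))
    have hx' : x ∈ P (insert x T) := Submodule.mem_sup_left
      ⟨NonUnitalAlgebra.subset_adjoin K (Or.inl (by simp)), hx⟩
    by_contra hxT
    refine hmax _ ⟨⟨_, hT'⟩, rfl⟩ ?_
    exact lt_of_le_of_ne hle fun heq => hxT (by
      rw [Subtype.mk.injEq] at heq
      rw [heq]
      exact hx')
  have hfg : (S T).toSubmodule.FG := by
    have h1 := hnil.fg_adjoin (s := T ∪ T.image (e * ·)) (by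
      intro x hx
      rcases Finset.mem_union.mp hx with hx | hx
      · exact hT.2 x hx
      · obtain ⟨y, hy, rfl⟩ := Finset.mem_image.mp hx
        simp [hT.2 y hy])
    rwa [Finset.coe_union, Finset.coe_image] at h1
  have : Module.Finite K (S T).toSubmodule := Module.Finite.iff_fg.mpr hfg
  have hfg' : ((S T).toSubmodule ⊓ I).FG :=
    Module.Finite.iff_fg.mp (Submodule.finiteDimensional_of_le inf_le_left)
  refine ⟨_, (Submodule.fg_span D₀.finite_toSet).sup hfg', ?_⟩
  rw [sup_assoc]
  change _ ⊔ P T = ⊤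
  rw [hPT, hD]

/-- A Noetherian Bernstein algebra with locally nilpotent barideal is finite-dimensional. -/
theorem IsNoetherianAlgebra.finiteDimensional [Infinite K] (h2 : (2 : K) ≠ 0)
    (h : IsBernstein ω) (hnil : IsLocallyNilpotent K (barideal ω))
    (hA : IsNoetherianAlgebra K A) : FiniteDimensional K A := by
  obtain ⟨e, he, hωe⟩ := h.exists_idempotent
  have H := h.peirceRules h2 he hωe
  have hN : IsIdeal (barideal ω).toSubmodule := isIdeal_of_mul_mem fun a x hx => by
    change ω (a * x) = 0
    rw [map_mul, show ω x = 0 from hx, mul_zero]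
  have step := fun {I J : Submodule K A} => hA.fg_sup_eq_top h2 h hnil he hωe (I := I) (J := J)
  have hideal := H.chain_isIdeal h2 h he hωe
  have hω : ∀ k, ∀ x ∈ H.chain k, ω x = 0 := fun k x => H.weight_of_mem_chain hωe
  have base : ∃ D : Submodule K A, D.FG ∧ D ⊔ (barideal ω).toSubmodule = ⊤ := by
    refine ⟨K ∙ e, Submodule.fg_span_singleton e, eq_top_iff.mpr fun x _ => ?_⟩
    refine Submodule.mem_sup.mpr ⟨ω x • e, Submodule.smul_mem _ _
      (Submodule.mem_span_singleton_self e), x - ω x • e, ?_, add_sub_cancel _ _⟩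
    change ω (x - ω x • e) = 0
    simp [hωe]
  have h3 := step hN (hideal 3) (hω 3) (fun x hx => hx)
    (fun x hx y hy => H.mul_mem_chain_three h2 h he hωe hx hy) base
  have chain_step : ∀ k, (∃ D : Submodule K A, D.FG ∧ D ⊔ H.chain (k + 1) = ⊤) →
      ∃ D : Submodule K A, D.FG ∧ D ⊔ H.chain k = ⊤ := fun k =>
    step (hideal _) (hideal _) (H.chain_le_succ k) (hω _)
      fun x hx y hy => H.chain_succ_mul h2 hx hy
  have h0 := chain_step 0 (chain_step 1 (chain_step 2 h3))
  have hL : H.annih 0 ≤ H.chain 0 := le_sup_left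
  have h0' := step (hideal 0) (H.annih_zero_isIdeal h2 h he hωe) hL (hω 0)
    (fun x hx y hy => H.chain_zero_mul h2 hx hy) h0
  obtain ⟨D, hD, hD'⟩ := step (J := ⊥) (H.annih_zero_isIdeal h2 h he hωe)
    (isIdeal_of_mul_mem fun a x hx => by simp [(Submodule.mem_bot K).mp hx]) bot_le
    (fun x hx => hω 0 x (hL hx))
    (fun x hx y hy => (Submodule.mem_bot K).mpr (H.annih_zero_mul hx (H.annih_le 0 hy))) h0'
  rw [sup_bot_eq] at hD'
  exact ⟨hD' ▸ hD⟩

end Noetherian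

/-! ### The left shift and its stable subspaces -/

noncomputable section Example

variable (K : Type u) [Field K]

/-- The left shift on finitely supported sequences. -/
def leftShift : (ℕ →₀ K) →ₗ[K] (ℕ →₀ K) :=
  Finsupp.lcomapDomain Nat.succ Nat.succ_injective

variable {K} in
theorem leftShift_apply (f : ℕ →₀ K) (i : ℕ) : leftShift K f i = f (i + 1) := rfl

variable {K} in
theorem leftShift_pow_apply (n : ℕ) (f : ℕ →₀ K) (i : ℕ) :
    (leftShift K ^ n) f i = f (i + n) := by
  induction n generalizing i with
  | zero => rfl
  | succ n ih =>
    rw [pow_succ', Module.End.mul_apply, leftShift_apply, ih, add_assoc, add_comm 1]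

variable {K} in
theorem exists_leftShift_pow_eq_zero (f : ℕ →₀ K) : ∃ n, (leftShift K ^ n) f = 0 := by
  refine ⟨f.support.sup id + 1, Finsupp.ext fun i => ?_⟩
  rw [leftShift_pow_apply, Finsupp.zero_apply, ← Finsupp.notMem_support_iff]
  intro h
  have := Finset.le_sup (f := id) h
  simp only [id] at this
  omega

/-- A subspace stable under the left shift contains the unit vectors up to the degree of each of
its elements. -/
theorem single_mem_of_stable {S : Submodule K (ℕ →₀ K)} (hS : ∀ f ∈ S, leftShift K f ∈ S)
    (n : ℕ) : ∀ f ∈ S, f n ≠ 0 → (∀ i, n < i → f i = 0) →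
      ∀ i ≤ n, Finsupp.single i (1 : K) ∈ S := by
  induction n with
  | zero =>
    intro f hf h0 hi i hi0
    obtain rfl : i = 0 := by omega
    have : Finsupp.single 0 (1 : K) = (f 0)⁻¹ • f := by
      ext j
      rcases Nat.eq_zero_or_pos j with rfl | hj
      · simp [h0]
      · simp [hi j hj, hj.ne]
    rw [this]
    exact S.smul_mem _ hf
  | succ n ih =>
    intro f hf h0 hi
    -- Shifting lowers the degree by one, so induction supplies all lower unit vectors; subtracting
    -- them from `f` isolates its leading term.
    have hlow := ih (leftShift K f) (hS f hf) h0 fun i hin => hi (i + 1) (by omega)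
    intro i hin
    rcases hin.lt_or_eq with hlt | rfl
    · exact hlow i (by omega)
    have : Finsupp.single (n + 1) (1 : K)
        = (f (n + 1))⁻¹ • (f - ∑ j ∈ Finset.range (n + 1), f j • Finsupp.single j (1 : K)) := by
      ext j
      simp only [Finsupp.smul_apply, Finsupp.sub_apply, Finsupp.finsetSum_apply, smul_eq_mul,
        Finsupp.single_apply, mul_ite, mul_one, mul_zero, Finset.sum_ite_eq', Finset.mem_range]
      rcases lt_trichotomy j (n + 1) with hj | rfl | hj
      · simp [hj, hj.ne']
      · simp [h0]
      · simp [hi j hj, hj.ne]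
    rw [this]
    refine S.smul_mem _ (S.sub_mem hf (S.sum_mem fun j hj => S.smul_mem _ (hlow j ?_)))
    rw [Finset.mem_range] at hj
    omega

/-- If the unit vector of index `i` is missing, no element of `S` can have degree `i` or more, so
`S` sits in the sequences supported below `i`. -/
theorem eq_top_or_finite_of_stable {S : Submodule K (ℕ →₀ K)}
    (hS : ∀ f ∈ S, leftShift K f ∈ S) : S = ⊤ ∨ FiniteDimensional K S := by
  by_cases h : ∀ i, Finsupp.single i (1 : K) ∈ S
  · refine Or.inl (eq_top_iff.mpr fun f _ => ?_)
    rw [← Finsupp.sum_single f]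
    refine S.sum_mem fun i _ => ?_
    rw [← mul_one (f i), ← smul_eq_mul, ← Finsupp.smul_single]
    exact S.smul_mem _ (h i)
  · push Not at h
    obtain ⟨i, hi⟩ := h
    refine Or.inr ?_
    have hle : S ≤ Finsupp.supported K K (Finset.range i : Set ℕ) := by
      intro f hf
      rw [Finsupp.mem_supported]
      intro j hj
      by_contra hji
      have hne : f.support.Nonempty := ⟨j, hj⟩
      refine hi (single_mem_of_stable K hS (f.support.max' hne) f hf
        (Finsupp.mem_support_iff.mp (Finset.max'_mem _ _)) (fun k hk => ?_) i ?_)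
      · by_contra hk0
        exact absurd (Finset.le_max' _ k (Finsupp.mem_support_iff.mpr hk0)) (not_le.mpr hk)
      · have h1 := Finset.le_max' _ j hj
        simp only [Finset.coe_range, Set.mem_Iio, not_lt] at hji
        omega
    have : FiniteDimensional K (Finsupp.supported K K (Finset.range i : Set ℕ)) :=
      (Finsupp.supportedEquivFinsupp (Finset.range i : Set ℕ)).symm.finiteDimensional
    exact Submodule.finiteDimensional_of_le hle

/-- Descending sequences of subspaces stable under the left shift are stationary. -/
theorem stationary_of_stable {S : ℕ → Submodule K (ℕ →₀ K)}
    (hS : ∀ n, ∀ f ∈ S n, leftShift K f ∈ S n) (hanti : Antitone S) :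
    ∃ n, ∀ m, n ≤ m → S m = S n := by
  by_cases h : ∀ n, S n = ⊤
  · exact ⟨0, fun m _ => by rw [h, h]⟩
  · push Not at h
    obtain ⟨n₀, hn₀⟩ := h
    have hfin : ∀ m, n₀ ≤ m → FiniteDimensional K (S m) := fun m hm =>
      have := (eq_top_or_finite_of_stable K (hS n₀)).resolve_left hn₀
      Submodule.finiteDimensional_of_le (hanti hm)
    obtain ⟨k, hk⟩ := WellFoundedLT.antitone_chain_condition 
      (f := fun k => Module.finrank K (S (n₀ + k))) (fun i j hij => by
        have := hfin (n₀ + i) (by omega)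
        exact Submodule.finrank_mono (hanti (by omega)))
    refine ⟨n₀ + k, fun m hm => ?_⟩
    have := hfin (n₀ + k) (by omega)
    have h1 := hk (m - n₀) (by omega)
    refine Submodule.eq_of_le_of_finrank_eq (hanti hm) ?_
    rw [Nat.add_sub_cancel' (by omega : n₀ ≤ m)] at h1
    exact h1.symm

/-! ### The Artinian, infinite-dimensional shift algebra -/

/-- The algebra `K e ⊕ U ⊕ K v` with `e * e = e`, `2 • (e * u) = u` for `u` in `U`, and with `v`
acting as the left shift on the space `U` of finitely supported sequences. -/
def ShiftAlgebra : Type u := K × (ℕ →₀ K) × K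

namespace ShiftAlgebra

instance : AddCommGroup (ShiftAlgebra K) := inferInstanceAs (AddCommGroup (K × (ℕ →₀ K) × K))

instance : Module K (ShiftAlgebra K) := inferInstanceAs (Module K (K × (ℕ →₀ K) × K))

/-- The product of the shift algebra. -/
def mul (x y : ShiftAlgebra K) : ShiftAlgebra K :=
  (x.1 * y.1, (2 : K)⁻¹ • (x.1 • y.2.1 + y.1 • x.2.1)
    + (x.2.2 • leftShift K y.2.1 + y.2.2 • leftShift K x.2.1), 0)

variable {K}

theorem ext {x y : ShiftAlgebra K} (h1 : x.1 = y.1) (h2 : x.2.1 = y.2.1) (h3 : x.2.2 = y.2.2) :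
    x = y := Prod.ext h1 (Prod.ext h2 h3)

instance : NonUnitalNonAssocCommRing (ShiftAlgebra K) where
  mul := mul K
  left_distrib x y z := ext (mul_add _ _ _)
    (by
      change (2 : K)⁻¹ • (x.1 • (y.2.1 + z.2.1) + (y.1 + z.1) • x.2.1)
        + (x.2.2 • leftShift K (y.2.1 + z.2.1) + (y.2.2 + z.2.2) • leftShift K x.2.1)
        = ((2 : K)⁻¹ • (x.1 • y.2.1 + y.1 • x.2.1)
          + (x.2.2 • leftShift K y.2.1 + y.2.2 • leftShift K x.2.1))
        + ((2 : K)⁻¹ • (x.1 • z.2.1 + z.1 • x.2.1)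
          + (x.2.2 • leftShift K z.2.1 + z.2.2 • leftShift K x.2.1))
      rw [map_add]
      module) (add_zero _).symm
  right_distrib x y z := ext (add_mul _ _ _)
    (by
      change (2 : K)⁻¹ • ((x.1 + y.1) • z.2.1 + z.1 • (x.2.1 + y.2.1))
        + ((x.2.2 + y.2.2) • leftShift K z.2.1 + z.2.2 • leftShift K (x.2.1 + y.2.1))
        = ((2 : K)⁻¹ • (x.1 • z.2.1 + z.1 • x.2.1)
          + (x.2.2 • leftShift K z.2.1 + z.2.2 • leftShift K x.2.1))
        + ((2 : K)⁻¹ • (y.1 • z.2.1 + z.1 • y.2.1)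
          + (y.2.2 • leftShift K z.2.1 + z.2.2 • leftShift K y.2.1))
      rw [map_add]
      module) (add_zero _).symm
  zero_mul x := ext (zero_mul _)
    (by
      change (2 : K)⁻¹ • ((0 : K) • x.2.1 + x.1 • (0 : ℕ →₀ K))
        + ((0 : K) • leftShift K x.2.1 + x.2.2 • leftShift K (0 : ℕ →₀ K)) = 0
      rw [map_zero]
      module) rfl
  mul_zero x := ext (mul_zero _)
    (by
      change (2 : K)⁻¹ • (x.1 • (0 : ℕ →₀ K) + (0 : K) • x.2.1)
        + (x.2.2 • leftShift K (0 : ℕ →₀ K) + (0 : K) • leftShift K x.2.1) = 0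
      rw [map_zero]
      module) rfl
  mul_comm x y := ext (mul_comm _ _)
    (by
      change (2 : K)⁻¹ • (x.1 • y.2.1 + y.1 • x.2.1)
        + (x.2.2 • leftShift K y.2.1 + y.2.2 • leftShift K x.2.1)
        = (2 : K)⁻¹ • (y.1 • x.2.1 + x.1 • y.2.1)
        + (y.2.2 • leftShift K x.2.1 + x.2.2 • leftShift K y.2.1)
      module) rfl

theorem mul_fst (x y : ShiftAlgebra K) : (x * y).1 = x.1 * y.1 := rfl

theorem mul_seq (x y : ShiftAlgebra K) : (x * y).2.1 = (2 : K)⁻¹ • (x.1 • y.2.1 + y.1 • x.2.1)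
    + (x.2.2 • leftShift K y.2.1 + y.2.2 • leftShift K x.2.1) := rfl

theorem mul_snd (x y : ShiftAlgebra K) : (x * y).2.2 = 0 := rfl

theorem smul_fst (c : K) (x : ShiftAlgebra K) : (c • x).1 = c * x.1 := rfl

theorem smul_seq (c : K) (x : ShiftAlgebra K) : (c • x).2.1 = c • x.2.1 := rfl

theorem smul_snd (c : K) (x : ShiftAlgebra K) : (c • x).2.2 = c * x.2.2 := rfl

instance : IsScalarTower K (ShiftAlgebra K) (ShiftAlgebra K) where
  smul_assoc c x y := by
    refine ext ?_ ?_ ?_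
    · simp only [smul_eq_mul, mul_fst, smul_fst]
      ring
    · simp only [smul_eq_mul, mul_seq, smul_seq, smul_fst, smul_snd, map_smul]
      module
    · simp only [smul_eq_mul, mul_snd, smul_snd]
      ring

instance : SMulCommClass K (ShiftAlgebra K) (ShiftAlgebra K) where
  smul_comm c x y := by
    rw [smul_eq_mul, smul_eq_mul, mul_comm x, mul_comm x, ← smul_eq_mul, ← smul_eq_mul,
      smul_assoc]

/-- The weight function of the shift algebra. -/
def weight : ShiftAlgebra K →ₙₐ[K] K where
  toFun x := x.1
  map_smul' c x := smul_fst c x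
  map_zero' := rfl
  map_add' _ _ := rfl
  map_mul' _ _ := rfl

/-- A product has no `v`-coordinate, so squaring `x * x` no longer involves the shift and only
rescales by its weight. -/
theorem isBernstein (h2 : (2 : K) ≠ 0) : IsBernstein (weight (K := K)) where
  weight_ne_zero h := one_ne_zero (α := K) (DFunLike.congr_fun h ((1, 0, 0) : ShiftAlgebra K))
  sq_sq x := by
    refine ext ?_ ?_ ?_
    · change (x * x * (x * x)).1 = (x.1 ^ 2 • (x * x)).1
      simp only [mul_fst, smul_fst]
      ring
    · change (x * x * (x * x)).2.1 = (x.1 ^ 2 • (x * x)).2.1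
      rw [mul_seq, smul_seq, mul_snd, mul_fst, zero_smul, add_zero, add_zero, ← two_smul K,
        smul_smul, inv_mul_cancel₀ h2, one_smul, sq]
    · change (x * x * (x * x)).2.2 = (x.1 ^ 2 • (x * x)).2.2
      simp only [mul_snd, smul_snd, mul_zero]

theorem not_finiteDimensional : ¬ FiniteDimensional K (ShiftAlgebra K) := by
  intro h
  have h1 : FiniteDimensional K (ℕ →₀ K) :=
    Module.Finite.of_surjective
      ({ toFun := fun x => x.2.1, map_add' := fun _ _ => rfl, map_smul' := smul_seq } :
        ShiftAlgebra K →ₗ[K] (ℕ →₀ K))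
      fun f => ⟨((0, f, 0) : K × (ℕ →₀ K) × K), rfl⟩
  exact (Finsupp.basisSingleOne (R := K) (ι := ℕ)).linearIndependent.finite.false

/-- The inclusion of the space of sequences. -/
def inclSeq : (ℕ →₀ K) →ₗ[K] ShiftAlgebra K :=
  (LinearMap.inr K K ((ℕ →₀ K) × K)).comp (LinearMap.inl K (ℕ →₀ K) K)

/-- The idempotent of the shift algebra. -/
def idem : ShiftAlgebra K := ((1, 0, 0) : K × (ℕ →₀ K) × K)

/-- The generator that acts as the left shift. -/
def shift : ShiftAlgebra K := ((0, 0, 1) : K × (ℕ →₀ K) × K)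

theorem eq_add (x : ShiftAlgebra K) : x = x.1 • idem + inclSeq x.2.1 + x.2.2 • shift := by
  refine ext ?_ ?_ ?_
  · change x.1 = x.1 * 1 + 0 + x.2.2 * 0
    ring
  · change x.2.1 = x.1 • 0 + x.2.1 + x.2.2 • 0
    simp
  · change x.2.2 = x.1 * 0 + 0 + x.2.2 * 1
    ring

theorem idem_mul (x : ShiftAlgebra K) : idem * x = x.1 • idem + (2 : K)⁻¹ • inclSeq x.2.1 := by
  refine ext ?_ ?_ ?_
  · change 1 * x.1 = x.1 * 1 + (2 : K)⁻¹ * 0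
    ring
  · change (2 : K)⁻¹ • ((1 : K) • x.2.1 + x.1 • (0 : ℕ →₀ K))
      + ((0 : K) • leftShift K x.2.1 + x.2.2 • leftShift K 0)
      = x.1 • (0 : ℕ →₀ K) + (2 : K)⁻¹ • x.2.1
    simp
  · change (0 : K) = x.1 * 0 + (2 : K)⁻¹ * 0
    ring

theorem shift_mul_inclSeq (f : ℕ →₀ K) : shift * inclSeq f = inclSeq (leftShift K f) := by
  refine ext ?_ ?_ ?_
  · change (0 : K) * 0 = 0
    ring
  · change (2 : K)⁻¹ • ((0 : K) • f + (0 : K) • (0 : ℕ →₀ K))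
      + ((1 : K) • leftShift K f + (0 : K) • leftShift K 0) = leftShift K f
    simp
  · rfl

theorem mem_of_isIdeal (h2 : (2 : K) ≠ 0) {I : Submodule K (ShiftAlgebra K)} (hI : IsIdeal I)
    {x : ShiftAlgebra K} (hx : x ∈ I) :
    x.1 • idem ∈ I ∧ inclSeq x.2.1 ∈ I ∧ x.2.2 • shift ∈ I := by
  have h1 := (hI idem x hx).1
  have h3 := (hI idem _ h1).1
  have hu : inclSeq x.2.1 ∈ I := by
    -- With `α` the weight and `u` the sequence of `x`, `e x = α e + u/2` and `e (e x) = α e + u/4`;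
    -- the difference is `u/4`.
    have h4 : (4 : K) • (idem * x - idem * (idem * x)) = inclSeq x.2.1 := by
      have h5 : idem * (x.1 • idem + (2 : K)⁻¹ • inclSeq x.2.1)
          = x.1 • idem + (4 : K)⁻¹ • inclSeq x.2.1 := by
        rw [idem_mul]
        refine ext ?_ ?_ ?_
        · change (x.1 * 1 + (2 : K)⁻¹ * 0) * 1 + (2 : K)⁻¹ * 0 = x.1 * 1 + (4 : K)⁻¹ * 0
          ring
        · change (x.1 * 1 + (2 : K)⁻¹ * 0) • (0 : ℕ →₀ K)
            + (2 : K)⁻¹ • (x.1 • (0 : ℕ →₀ K) + (2 : K)⁻¹ • x.2.1)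
            = x.1 • (0 : ℕ →₀ K) + (4 : K)⁻¹ • x.2.1
          rw [show (4 : K)⁻¹ = 2⁻¹ * 2⁻¹ by rw [← mul_inv]; norm_num]
          module
        · change (x.1 * 1 + (2 : K)⁻¹ * 0) * 0 + (2 : K)⁻¹ * 0 = x.1 * 0 + (4 : K)⁻¹ * 0
          ring
      rw [idem_mul, h5, add_sub_add_left_eq_sub, ← sub_smul, smul_smul,
        show (4 : K) = 2 * 2 by norm_num, show (2 * 2 : K) * (2⁻¹ - (2 * 2)⁻¹) = 1 by
          field_simp; norm_num, one_smul]
    rw [← h4]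
    exact I.smul_mem _ (I.sub_mem h1 h3)
  have he : x.1 • idem ∈ I := by
    rw [idem_mul] at h1
    exact (I.add_mem_iff_left (I.smul_mem _ hu)).mp h1
  refine ⟨he, hu, ?_⟩
  rw [eq_add x] at hx
  exact (I.add_mem_iff_right (I.add_mem he hu)).mp hx

theorem le_of_isIdeal (h2 : (2 : K) ≠ 0) {I J : Submodule K (ShiftAlgebra K)} (hI : IsIdeal I)
    (hidem : idem ∈ I → idem ∈ J) (hseq : I.comap inclSeq ≤ J.comap inclSeq)
    (hshift : shift ∈ I → shift ∈ J) : I ≤ J := by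
  intro x hx
  obtain ⟨h1, h3, h4⟩ := mem_of_isIdeal h2 hI hx
  have aux : ∀ (c : K) (y : ShiftAlgebra K), (y ∈ I → y ∈ J) → c • y ∈ I → c • y ∈ J := by
    intro c y hy hc
    rcases eq_or_ne c 0 with rfl | hc0
    · rw [zero_smul]
      exact J.zero_mem
    · exact J.smul_mem _ (hy ((I.smul_mem_iff hc0).mp hc))
  rw [eq_add x]
  exact J.add_mem (J.add_mem (aux _ _ hidem h1) (hseq h3)) (aux _ _ hshift h4)

/-- If `p` fails somewhere, that index makes the implication vacuous. Applied to membership of a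
fixed vector in a descending chain, this is stationarity. -/
theorem exists_stationary (p : ℕ → Prop) :
    ∃ n, ∀ m, n ≤ m → (p n → p m) := by
  by_cases h : ∀ n, p n
  · exact ⟨0, fun m _ _ => h m⟩
  · push Not at h
    obtain ⟨n, hn⟩ := h
    exact ⟨n, fun m _ h => absurd h hn⟩

theorem isArtinianAlgebra (h2 : (2 : K) ≠ 0) : IsArtinianAlgebra K (ShiftAlgebra K) := by
  intro I hI hanti
  obtain ⟨n₁, h₁⟩ := exists_stationary fun n => idem ∈ I n
  obtain ⟨n₂, h₂⟩ := exists_stationary fun n => shift ∈ I n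
  obtain ⟨n₃, h₃⟩ := stationary_of_stable K (S := fun n => (I n).comap inclSeq)
    (fun n f hf => by
      rw [Submodule.mem_comap, ← shift_mul_inclSeq]
      exact (hI n shift _ hf).1)
    (fun m n hmn => Submodule.comap_mono (hanti hmn))
  refine ⟨n₁ + n₂ + n₃, fun m hm => le_antisymm (hanti hm) ?_⟩
  refine le_of_isIdeal h2 (hI _) (fun h => ?_) ?_ (fun h => ?_)
  · exact h₁ m (by omega) (hanti (by omega) h)
  · exact ((h₃ _ (by omega)).trans (h₃ m (by omega)).symm).le
  · exact h₂ m (by omega) (hanti (by omega) h)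

theorem isLocallyNilpotent : IsLocallyNilpotent K (barideal (weight (K := K))) := by
  intro s
  obtain ⟨n, hn⟩ : ∃ n, ∀ x ∈ s, (leftShift K ^ n) x.1.2.1 = 0 := by
    choose f hf using fun x : ShiftAlgebra K => exists_leftShift_pow_eq_zero x.2.1
    refine ⟨s.sup fun x => f x.1, fun x hx => ?_⟩
    obtain ⟨k, hk⟩ := Nat.exists_eq_add_of_le' (Finset.le_sup (f := fun x => f x.1) hx)
    rw [hk, pow_add, Module.End.mul_apply, hf, map_zero]
  set S := NonUnitalAlgebra.adjoin K (s : Set (barideal (weight (K := K))))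
  have hfst : ∀ x : S, x.1.1.1 = 0 := fun x => x.1.2
  have hmul : ∀ x y : S, (x * y).1.1.2.1
      = x.1.1.2.2 • leftShift K y.1.1.2.1 + y.1.1.2.2 • leftShift K x.1.1.2.1 := by
    intro x y
    change (x.1.1 * y.1.1).2.1 = _
    rw [mul_seq, hfst, hfst]
    simp
  have hle : ∀ {a b : ℕ} {f : ℕ →₀ K}, a ≤ b → (leftShift K ^ a) f = 0 →
      (leftShift K ^ b) f = 0 := by
    intro a b f hab h
    obtain ⟨k, rfl⟩ := Nat.exists_eq_add_of_le' hab
    rw [pow_add, Module.End.mul_apply, h, map_zero]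
  have hshift : ∀ {a : ℕ} {f : ℕ →₀ K}, (leftShift K ^ a) f = 0 →
      (leftShift K ^ (a - 1)) (leftShift K f) = 0 := by
    intro a f h
    rw [← Module.End.mul_apply, ← pow_succ]
    exact hle (by omega) h
  have hS : ∀ x : S, (leftShift K ^ n) x.1.1.2.1 = 0 := by
    rintro ⟨x, hx⟩
    change (leftShift K ^ n) x.1.2.1 = 0
    induction hx using NonUnitalAlgebra.adjoin_induction with
    | mem x hx => exact hn x hx
    | add x y hx hy h1 h2 =>
      change (leftShift K ^ n) (x.1.2.1 + y.1.2.1) = 0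
      rw [map_add, h1, h2, add_zero]
    | zero => exact map_zero _
    | mul x y hx hy h1 h2 =>
      change (leftShift K ^ n) ((⟨x, hx⟩ * ⟨y, hy⟩ : S).1.1.2.1) = 0
      rw [hmul, map_add, map_smul, map_smul, hle (Nat.sub_le n 1) (hshift h1),
        hle (Nat.sub_le n 1) (hshift h2), smul_zero, smul_zero, add_zero]
    | smul r x hx h1 =>
      change (leftShift K ^ n) (r • x.1.2.1) = 0
      rw [map_smul, h1, smul_zero]
  -- The filtration bounding the powers of `S`: each further factor spends one shift, and from the
  -- second power on the `v`-coordinate is gone.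
  let Q : ℕ → Submodule K S := fun k =>
    { carrier := {x | (leftShift K ^ (n + 1 - k)) x.1.1.2.1 = 0 ∧ (2 ≤ k → x.1.1.2.2 = 0)}
      add_mem' := by
        rintro x y ⟨hx, hx'⟩ ⟨hy, hy'⟩
        refine ⟨?_, fun hk => ?_⟩
        · change (leftShift K ^ (n + 1 - k)) (x.1.1.2.1 + y.1.1.2.1) = 0
          rw [map_add, hx, hy, add_zero]
        · change x.1.1.2.2 + y.1.1.2.2 = 0
          rw [hx' hk, hy' hk, add_zero]
      zero_mem' := ⟨map_zero _, fun _ => rfl⟩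
      smul_mem' := by
        rintro c x ⟨hx, hx'⟩
        refine ⟨?_, fun hk => ?_⟩
        · change (leftShift K ^ (n + 1 - k)) (c • x.1.1.2.1) = 0
          rw [map_smul, hx, smul_zero]
        · change c * x.1.1.2.2 = 0
          rw [hx' hk, mul_zero] }
  have hpow : ∀ k, power K S (k + 1) ≤ Q (k + 1) := by
    intro k
    induction k using Nat.strong_induction_on with
    | _ k ih =>
      cases k with
      | zero => exact fun x _ => ⟨hS x, fun h => by omega⟩
      | succ k =>
        have aux : ∀ (i j : ℕ) (c : K) (f : ℕ →₀ K), i + j = k → (2 ≤ i + 1 → c = 0) →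
            (leftShift K ^ (n + 1 - (j + 1))) f = 0 →
            (leftShift K ^ (n + 1 - (k + 2))) (c • leftShift K f) = 0 := by
          intro i j c f hij hc hf
          rw [map_smul]
          -- Only a factor from the first power can act as a shift; the other factor then lies in
          -- the preceding power, and its exponent drops by one.
          rcases Nat.eq_zero_or_pos i with rfl | hi
          · rw [hle (by omega) (hshift hf), smul_zero]
          · rw [hc (by omega), zero_smul]
        rw [power]
        refine iSup_le fun i => Submodule.map₂_le.mpr fun x hx y hy => ?_
        obtain ⟨i, hi⟩ := i
        obtain ⟨j, rfl⟩ : ∃ j, k = i + j := ⟨k - i, by omega⟩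
        have hj : i + j + 1 - i = j + 1 := by omega
        dsimp only at hx hy
        rw [hj] at hy
        obtain ⟨hx1, hx2⟩ := ih i (by omega) hx
        obtain ⟨hy1, hy2⟩ := ih j (by omega) hy
        refine ⟨?_, fun _ => rfl⟩
        change (leftShift K ^ (n + 1 - (i + j + 2))) (x * y).1.1.2.1 = 0
        rw [hmul, map_add, aux i j _ _ rfl hx2 hy1, aux j i _ _ (by omega) hy2 hx1, add_zero]
  -- The truncated exponent `n + 1 - k` is already 0 at `k = n + 1`; taking `n + 2` guarantees `2 ≤
  -- k` even when `n = 0`.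
  refine ⟨n + 2, by omega, eq_bot_iff.mpr fun x hx => ?_⟩
  obtain ⟨h1, h2⟩ := hpow (n + 1) hx
  rw [Submodule.mem_bot]
  refine Subtype.ext (Subtype.ext (ext (hfst x) ?_ (h2 (by omega))))
  rw [show n + 1 - (n + 1 + 1) = 0 by omega] at h1
  exact h1

end ShiftAlgebra

end Example

end BernsteinAlg

theorem corollary4p8 {K : Type u} [Field K] [Infinite K]
    (h2 : ringChar K ≠ 2) (h3 : ringChar K ≠ 3) :
    (∀ (A : Type v) [NonUnitalNonAssocCommRing A] [Module K A] [IsScalarTower K A A]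
        [SMulCommClass K A A] (ω : A →ₙₐ[K] K),
        BernsteinAlg.IsBernstein ω →
        BernsteinAlg.IsLocallyNilpotent K (BernsteinAlg.barideal ω) →
        BernsteinAlg.IsNoetherianAlgebra K A →
        FiniteDimensional K A) ∧
    (∃ (A : Type u) (_ : NonUnitalNonAssocCommRing A) (_ : Module K A) (_ : IsScalarTower K A A)
        (_ : SMulCommClass K A A) (ω : A →ₙₐ[K] K),
        BernsteinAlg.IsBernstein ω ∧
        BernsteinAlg.IsLocallyNilpotent K (BernsteinAlg.barideal ω) ∧
        BernsteinAlg.IsArtinianAlgebra K A ∧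
        ¬ FiniteDimensional K A) := by
  have h2' : (2 : K) ≠ 0 := Ring.two_ne_zero h2
  exact ⟨fun A _ _ _ _ ω h hnil hA => hA.finiteDimensional h2' h hnil,
    BernsteinAlg.ShiftAlgebra K, inferInstance, inferInstance, inferInstance, inferInstance,
    BernsteinAlg.ShiftAlgebra.weight, BernsteinAlg.ShiftAlgebra.isBernstein h2',
    BernsteinAlg.ShiftAlgebra.isLocallyNilpotent,
    BernsteinAlg.ShiftAlgebra.isArtinianAlgebra h2',
    BernsteinAlg.ShiftAlgebra.not_finiteDimensional⟩
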